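/- Let $\mathbb{T}=\{w_1+i_2w_2:\ w_1,w_2\in\mathbb{C}\}$ be the bicomplex numbers, with real coordinates $\zeta=x_0+i_1x_1+i_2x_2+jx_3$, where $i_1$ is the imaginary unit of $\mathbb{C}$, $i_1^2=i_2^2=-1$, $j=i_1i_2$, $j^2=1$. Write $\operatorname{Re}\zeta=x_0$, $\operatorname{Im}_j\zeta=x_3$; let $e_{1}=\frac{1+j}{2}$, $e_2=\frac{1-j}{2}$ and $\zeta=\zeta_1e_1+\zeta_2e_2$ with $\zeta_1=w_1-i_1w_2$, $\zeta_2=w_1+i_1w_2$. Powers $t^{\nu}$ ($t>0$) and $1/\Gamma(\nu)$ of $\nu\in\mathbb{T}$ are taken in each idempotent component, with $1/\Gamma=0$ at the poles of $\Gamma$. For bicomplex arguments put $$\mathbb{E}^{\delta}_{\varsigma,\tau}(\zeta)=\sum_{k=0}^\infty\frac{(\delta)_k}{k!\,\Gamma(\varsigma k+\tau)}\zeta^k,\qquad {}_0D_t^{-\nu}g(t)=\frac1{\Gamma(\nu)}\int_0^t(t-v)^{\nu-1}g(v)\,dv .$$ **Theorem.** Let $n\ge1$, $N_0\in\mathbb{T}$,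 let $\nu_1,\dots,\nu_n\in\mathbb{T}$ satisfy $|\operatorname{Im}_j(\nu_i)|<\operatorname{Re}(\nu_i)$, let $a_i=a_{i_1}+j\,a_{i_4}$ ($1\le i\le n$) be hyperbolic numbers ($a_{i_1},a_{i_4}\in\mathbb{R}$) with $a_{i_1}>|a_{i_4}|$, and let $f:(0,\infty)\to\mathbb{T}$ be Lebesgue integrable. For $s=(s_1,\dots,s_{n-1})\in\mathbb{Z}_{\ge0}^{n-1}$ put $|s|=\sum_{\mu} s_\mu$, $\tau_s=\sum_{\mu=1}^{n-1}s_\mu\nu_{\mu+1}$ and $$I_s(t)=\int_0^t f(v)\,(t-v)^{\tau_s-1}\,\mathbb{E}^{|s|+1}_{\nu_1,\tau_s}\!\left(-a_1(t-v)^{\nu_1}\right)dv .$$ Then the equation $$N(t)-N_0f(t)=-\sum_{i=1}^n a_i\ {}_0D_t^{-\nu_i}N(t)$$ is solvable, with the particular solution $$N(t)=N_0\Big[f(t)+\sum_{l=0}^\infty(-1)^l\sum_{s_1+\dots+s_{n-1}=l}\frac{l!}{s_1!\cdots s_{n-1}!}\Big(\prod_{\mu=1}^{n-1}a_{\mu+1}^{s_\mu}\Big)I_s(t)\Big].$$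 (The summand $f(t)$ comes from $s=0$, where $\tau_s=0$: the leading term $u^{\tau-1}/\Gamma(\tau)$ of the convolution kernel is at $\tau=0$ the Dirac mass at $0$, which is not contained in the pointwise formula for the kernel.) More precisely: all the integrals $I_s(t)$ converge absolutely for almost every $t>0$; $N$ is integrable on $(0,T)$ for every $T>0$; and at every $t>0$ at which all the integrals $I_s(t)$ converge absolutely, the series converges, the fractional integrals ${}_0D_t^{-\nu_i}N(t)$ converge absolutely, and the equation holds. -/

import Mathlib

open MeasureTheory Set

noncomputable section

/-- The bicomplex numbers `w₁ + i₂ w₂` with `w₁, w₂ ∈ ℂ` and `i₂² = -1`, as a commutative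
`ℂ`-algebra: `w₁` is the field `re` and `w₂` the field `im`, and the imaginary unit of `ℂ`
plays the role of `i₁`. -/
abbrev Bicomplex : Type := QuadraticAlgebra ℂ (-1) 0

namespace Bicomplex

theorem re_one : (1 : Bicomplex).re = 1 := rfl

theorem im_one : (1 : Bicomplex).im = 0 := rfl

/-- Real coordinates: `(w₁, w₂)` as a point of the Euclidean space `ℂ² = ℝ⁴`. -/
def toEuclidean : Bicomplex →ₗ[ℝ] WithLp 2 (ℂ × ℂ) where
  toFun ζ := WithLp.toLp 2 (ζ.re, ζ.im)
  map_add' _ _ := rfl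
  map_smul' _ _ := rfl

theorem toEuclidean_injective : Function.Injective toEuclidean := by
  intro x y h
  have h' : (x.re, x.im) = (y.re, y.im) := congrArg WithLp.ofLp h
  exact QuadraticAlgebra.ext (congrArg Prod.fst h') (congrArg Prod.snd h')

/-- The Euclidean norm `‖ζ‖ = √(|w₁|² + |w₂|²)`. -/
instance instNormedAddCommGroup : NormedAddCommGroup Bicomplex :=
  NormedAddCommGroup.induced Bicomplex (WithLp 2 (ℂ × ℂ)) toEuclidean toEuclidean_injective

instance instNormedSpace : NormedSpace ℝ Bicomplex :=
  NormedSpace.induced ℝ Bicomplex (WithLp 2 (ℂ × ℂ)) toEuclidean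

theorem norm_eq (ζ : Bicomplex) : ‖ζ‖ = Real.sqrt (‖ζ.re‖ ^ 2 + ‖ζ.im‖ ^ 2) :=
  WithLp.prod_norm_eq_of_L2 (toEuclidean ζ)

instance instFiniteDimensional : FiniteDimensional ℝ Bicomplex :=
  FiniteDimensional.of_injective toEuclidean toEuclidean_injective

instance instCompleteSpace : CompleteSpace Bicomplex := FiniteDimensional.complete ℝ Bicomplex

/-- The unit `i₁`. -/
def i₁ : Bicomplex := ⟨Complex.I, 0⟩

/-- The unit `i₂`. -/
def i₂ : Bicomplex := ⟨0, 1⟩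

/-- The hyperbolic unit `j = i₁ i₂`, with `j² = 1`. -/
def j : Bicomplex := i₁ * i₂

theorem j_mul_j : j * j = 1 := by
  ext <;> simp [j, i₁, i₂, re_one, im_one]

/-- The coefficient `x₀` in `ζ = x₀ + i₁ x₁ + i₂ x₂ + j x₃`. -/
def realPart (ζ : Bicomplex) : ℝ := ζ.re.re

/-- The coefficient `x₃` in `ζ = x₀ + i₁ x₁ + i₂ x₂ + j x₃`. -/
def jPart (ζ : Bicomplex) : ℝ := ζ.im.im

/-- The real-coordinate form `ζ = x₀ + i₁ x₁ + i₂ x₂ + j x₃`. -/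
theorem eq_coords (ζ : Bicomplex) :
    ζ = algebraMap ℝ Bicomplex (realPart ζ) + algebraMap ℝ Bicomplex ζ.re.im * i₁ +
      algebraMap ℝ Bicomplex ζ.im.re * i₂ + algebraMap ℝ Bicomplex (jPart ζ) * j := by
  simp only [Algebra.algebraMap_eq_smul_one, smul_mul_assoc, one_mul]
  ext <;> apply Complex.ext <;> simp [j, i₁, i₂, realPart, jPart, re_one, im_one]

/-- Hyperbolic numbers: `x₀ + x₃ j` with `x₀, x₃` real. -/
def IsHyperbolic (ζ : Bicomplex) : Prop :=
  ∃ x₀ x₃ : ℝ, ζ = algebraMap ℝ Bicomplex x₀ + algebraMap ℝ Bicomplex x₃ * j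

/-- First idempotent component `ζ₁ = w₁ - i₁ w₂`. -/
def P₁ (ζ : Bicomplex) : ℂ := ζ.re - Complex.I * ζ.im

/-- Second idempotent component `ζ₂ = w₁ + i₁ w₂`. -/
def P₂ (ζ : Bicomplex) : ℂ := ζ.re + Complex.I * ζ.im

/-- The idempotent `e₁ = (1 + i₁ i₂) / 2`. -/
def e₁ : Bicomplex := (1 / 2 : ℂ) • (1 + j)

/-- The idempotent `e₂ = (1 - i₁ i₂) / 2`. -/
def e₂ : Bicomplex := (1 / 2 : ℂ) • (1 - j)

/-- The bicomplex number `z₁ e₁ + z₂ e₂` with idempotent components `z₁, z₂ ∈ ℂ`. -/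
def ofIdem (z₁ z₂ : ℂ) : Bicomplex := z₁ • e₁ + z₂ • e₂

/-- The idempotent representation `ζ = ζ₁ e₁ + ζ₂ e₂`. -/
theorem ofIdem_P (ζ : Bicomplex) : ofIdem (P₁ ζ) (P₂ ζ) = ζ := by
  ext <;> simp [ofIdem, P₁, P₂, e₁, e₂, j, i₁, i₂, re_one, im_one]
  · ring
  · linear_combination (-ζ.im) * Complex.I_sq

/-- The power `t ^ ν = t ^ ν₁ e₁ + t ^ ν₂ e₂` of a positive real `t` to a bicomplex exponent. -/
def realPow (t : ℝ) (ν : Bicomplex) : Bicomplex :=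
  ofIdem ((t : ℂ) ^ P₁ ν) ((t : ℂ) ^ P₂ ν)

/-- The reciprocal bicomplex Gamma function `1 / Γ(ζ) = (1 / Γ(ζ₁)) e₁ + (1 / Γ(ζ₂)) e₂`.
As usual, `1 / Γ` vanishes at the poles `0, -1, -2, …` of the complex Gamma function
(Mathlib's `Complex.Gamma` is `0` there, so the inverse is `0` as well). -/
def invGamma (ζ : Bicomplex) : Bicomplex :=
  ofIdem (Complex.Gamma (P₁ ζ))⁻¹ (Complex.Gamma (P₂ ζ))⁻¹

/-- The bicomplex Prabhakar function
`E^δ_{ς,τ}(ζ) = ∑ₖ (δ)ₖ / (k! Γ(ς k + τ)) ζ ^ k`. -/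
def prabhakar (ς τ δ ζ : Bicomplex) : Bicomplex :=
  ∑' k : ℕ, ((k.factorial : ℝ)⁻¹) •
    ((ascPochhammer Bicomplex k).eval δ * invGamma (ς * (k : Bicomplex) + τ) * ζ ^ k)

/-- The integrand `v ↦ (t - v) ^ (ν - 1) g(v)` of the Riemann–Liouville integral of order `ν`. -/
def rlIntegrand (ν : Bicomplex) (g : ℝ → Bicomplex) (t v : ℝ) : Bicomplex :=
  realPow (t - v) (ν - 1) * g v

/-- The Riemann–Liouville fractional integral
`₀D_t^{-ν} g(t) = (1 / Γ(ν)) ∫₀ᵗ (t - v) ^ (ν - 1) g(v) dv`. -/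
def rlIntegral (ν : Bicomplex) (g : ℝ → Bicomplex) (t : ℝ) : Bicomplex :=
  invGamma ν * ∫ v in Ioo 0 t, rlIntegrand ν g t v

/-- For `n = m + 1` and a multi-index `s = (s₁, …, s_{n-1})` of weight `l = ∑ s_μ`, the integrand
`f(v) (t - v) ^ (τ - 1) E^{l+1}_{ν₁,τ}(-a₁ (t - v) ^ ν₁)` with `τ = ∑ s_μ ν_{μ+1}`.
Orders and coefficients are indexed from `0`, so `ν₁ = ν 0` and `ν_{μ+1} = ν μ.succ`. -/
def seriesIntegrand {m : ℕ} (a ν : Fin (m + 1) → Bicomplex) (f : ℝ → Bicomplex)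
    (s : Fin m → ℕ) (t v : ℝ) : Bicomplex :=
  f v * realPow (t - v) ((∑ μ, (s μ : Bicomplex) * ν μ.succ) - 1) *
    prabhakar (ν 0) (∑ μ, (s μ : Bicomplex) * ν μ.succ) ((∑ μ, (s μ : Bicomplex)) + 1)
      (-(a 0) * realPow (t - v) (ν 0))

/-- The `l`-th term
`(-1) ^ l ∑_{s₁+…+s_{n-1}=l} l! / (s₁! ⋯ s_{n-1}!) (∏ a_{μ+1} ^ s_μ) ∫₀ᵗ …` of the series. -/
def seriesTerm {m : ℕ} (a ν : Fin (m + 1) → Bicomplex) (f : ℝ → Bicomplex)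
    (t : ℝ) (l : ℕ) : Bicomplex :=
  (-1) ^ l * ∑ s ∈ Finset.piAntidiag (Finset.univ : Finset (Fin m)) l,
    (Nat.multinomial Finset.univ s : Bicomplex) * (∏ μ, a μ.succ ^ s μ) *
      ∫ v in Ioo 0 t, seriesIntegrand a ν f s t v

/-- The function `N(t) = N₀ (f(t) + ∑ₗ (l-th term))`. The summand `f(t)` is the contribution of
the only multi-index with `τ = 0`, namely `s = 0`: the leading term `u ^ (τ - 1) / Γ(τ)` of the
convolution kernel is the Dirac mass at `0` when `τ = 0`, whereas in the pointwise formula for the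
kernel `1 / Γ(0) = 0`. -/
def kineticSolution {m : ℕ} (a ν : Fin (m + 1) → Bicomplex) (N₀ : Bicomplex)
    (f : ℝ → Bicomplex) (t : ℝ) : Bicomplex :=
  N₀ * (f t + ∑' l : ℕ, seriesTerm a ν f t l)

end Bicomplex

end

/-!
The idempotent components `ζ ↦ ζ₁, ζ₂` are ring homomorphisms `Bicomplex → ℂ` that jointly
determine `ζ`, and each of them carries the equation to the same equation with complex data
`aᵢ ≠ 0`, `Re νᵢ > 0`. So the argument takes place over `ℂ`.

Put `g_β(u) = u ^ (β - 1) / Γ(β)`. With `G = ∑ aᵢ g_{νᵢ}` the equation reads `N - N₀ f = -G * N`,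
and it is solved by `N = N₀ (f + H * f)` as soon as the kernel `H` satisfies the resolvent equation
`H = -G - G * H`. Expanding the Neumann series `∑ₙ (-1)ⁿ G^{*n}` by `g_α * g_β = g_{α + β}` gives
`H = ∑_{r ≠ 0} c_r g_{r·ν}`, summed over multi-indices `r` with
`c_r = (-1)^|r| |r|! / ∏ rᵢ! ∏ aᵢ ^ rᵢ`; the terms with fixed last coordinates `s` add up to the
Prabhakar kernel of the statement (`blockKernel_eq`). The resolvent equation (`resolvent_eq`) is
Pascal's rule for multinomial coefficients.

Three estimates carry the analysis.

* Convergence. Since `|B(α, β)| ≤ B(Re α, Re β)`, the ratio `Γ(Re β) / |Γ(β)|` is submultiplicative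
  (`gammaRatio_add_le`). This bounds `1 / |Γ(r·ν)|` by a geometric factor over `Γ(r · Re ν)`, which
  grows faster than any exponential, and hence dominates the `r`-th term on `(0, T]` by a summable
  sequence times `u ^ (ξ - 1)`, where `ξ = min Re νᵢ` (`exists_summable_bound`).
* Admissible times. If `∫₀ᵗ |f(v)| (t - v) ^ (ξ - 1) dv < ∞`, then all convolutions of `f` at `t`
  converge absolutely and Fubini gives `g * (H * f) = (g * H) * f` at this very `t`
  (`IsAdmissible.rlKernel_conv_conv`). Almost every `t` is admissible, because convolutions of
  integrable functions exist almost everywhere.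
* Converse. If all the integrals `I_s(t)` converge absolutely, then `t` is admissible: the block
  `s = 0` or `s = e_μ` that contains the order `νᵢ` of minimal real part is comparable with
  `u ^ (ξ - 1)` near `u = 0` (`isAdmissible_of_forall_block`).
-/

namespace FractionalKinetic

/-! ### Integrability of the Beta integrand -/

theorem integrableOn_rpow_mul_rpow {x y : ℝ} (hx : 0 < x) (hy : 0 < y) {t : ℝ} (ht : 0 < t) :
    IntegrableOn (fun w : ℝ => w ^ (x - 1) * (t - w) ^ (y - 1)) (Ioo 0 t) := by
  have hhalf : ∀ p q : ℝ, 0 < p →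
      IntegrableOn (fun w : ℝ => w ^ (p - 1) * (t - w) ^ (q - 1)) (Ioc 0 (t / 2)) := by
    intro p q hp
    have h1 : IntegrableOn (fun w : ℝ => w ^ (p - 1)) (Ioc 0 (t / 2)) :=
      (intervalIntegral.intervalIntegrable_rpow' (show -1 < p - 1 by linarith)).1
    rw [← integrableOn_Icc_iff_integrableOn_Ioc] at h1 ⊢
    refine h1.mul_continuousOn ?_ isCompact_Icc
    refine ContinuousOn.rpow_const (by fun_prop) fun w hw => Or.inl ?_
    have := hw.2
    linarith
  have hl := hhalf x y hx
  have hr : IntegrableOn (fun w : ℝ => w ^ (x - 1) * (t - w) ^ (y - 1)) (Ico (t / 2) t) := by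
    have h := (MeasurePreserving.integrableOn_comp_preimage
      (Measure.measurePreserving_sub_left volume t)
      (Homeomorph.subLeft t).measurableEmbedding).2 (hhalf y x hy)
    have hs : (fun w : ℝ => t - w) ⁻¹' Ioc 0 (t / 2) = Ico (t / 2) t := by
      ext w
      simp only [mem_preimage, mem_Ioc, mem_Ico]
      constructor <;> rintro ⟨h₁, h₂⟩ <;> constructor <;> linarith
    rw [hs] at h
    refine h.congr_fun (fun w _ => ?_) measurableSet_Ico
    simp [mul_comm]
  refine (hl.union hr).mono_set fun w hw => ?_
  rcases le_total w (t / 2) with h | h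
  · exact Or.inl ⟨hw.1, h⟩
  · exact Or.inr ⟨h, hw.2⟩

/-! ### Bounds for the reciprocal Gamma function -/

/-- Obtained by restricting the Gamma integral to `(l, ∞)`, where `u ^ x ≥ l ^ x`. -/
theorem rpow_mul_exp_neg_le_Gamma_add_one {l x : ℝ} (hl : 0 < l) (hx : 0 < x) :
    l ^ x * Real.exp (-l) ≤ Real.Gamma (x + 1) := by
  rw [Real.Gamma_eq_integral (by linarith), ← integral_exp_neg_Ioi, ← integral_const_mul]
  have hi := Real.GammaIntegral_convergent (s := x + 1) (by linarith)
  refine (setIntegral_mono_on (f := fun u => l ^ x * Real.exp (-u)) ?_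
    (hi.mono_set (Ioi_subset_Ioi hl.le)) measurableSet_Ioi ?_).trans
    (setIntegral_mono_set hi ?_ (Ioi_subset_Ioi hl.le).eventuallyLE)
  · exact (integrableOn_exp_neg_Ioi l).const_mul _
  · intro u hu
    have hu' : l < u := hu
    rw [add_sub_cancel_right, mul_comm]
    gcongr
  · filter_upwards [ae_restrict_mem measurableSet_Ioi] with u hu
    have hu' : 0 < u := hu
    simp only [Pi.zero_apply]
    positivity

/-- The reciprocal Gamma function decays faster than any exponential on the positive half-line. -/
theorem exists_inv_Gamma_le {q : ℝ} (hq : 0 < q) :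
    ∃ C : ℝ, 0 < C ∧ ∀ x : ℝ, 0 < x → (Real.Gamma x)⁻¹ ≤ C * q ^ x := by
  -- With `l = e / q`: `1 / Γ(x) = x / Γ(x + 1) ≤ e ^ x * e ^ l * l ^ (-x) = e ^ l * q ^ x`.
  refine ⟨Real.exp (Real.exp 1 / q), Real.exp_pos _, fun x hx => ?_⟩
  set l := Real.exp 1 / q with hl_def
  have hl : 0 < l := by positivity
  have h := rpow_mul_exp_neg_le_Gamma_add_one hl hx
  rw [Real.Gamma_add_one hx.ne'] at h
  have hG := Real.Gamma_pos_of_pos hx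
  have hx' : x ≤ Real.exp x := by linarith [Real.add_one_le_exp x]
  have hlx : l ^ x * q ^ x = Real.exp x := by
    rw [← Real.mul_rpow hl.le hq.le, hl_def, div_mul_cancel₀ _ hq.ne', ← Real.exp_mul, one_mul]
  rw [inv_le_iff_one_le_mul₀ hG]
  have h2 : l ^ x * Real.exp (-l) ≤ Real.exp x * Real.Gamma x :=
    h.trans (by gcongr)
  have h3 : l ^ x * Real.exp (-l) * (q ^ x * Real.exp l) = Real.exp x := by
    rw [← hlx]
    have : Real.exp (-l) * Real.exp l = 1 := by rw [← Real.exp_add]; simp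
    linear_combination (l ^ x * q ^ x) * this
  have h4 : Real.exp x ≤ Real.exp x * Real.Gamma x * (q ^ x * Real.exp l) := by
    calc Real.exp x = _ := h3.symm
      _ ≤ _ := by gcongr
  have h5 : Real.exp x * 1 ≤ Real.exp x * (Real.exp l * q ^ x * Real.Gamma x) := by
    linarith
  exact le_of_mul_le_mul_left h5 (Real.exp_pos x)

/-- The ratio `Γ(Re β) / |Γ(β)|`, with the value `1` at `β = 0` that makes it submultiplicative
on `{0} ∪ {Re β > 0}`. -/
noncomputable def gammaRatio (β : ℂ) : ℝ :=
  if β = 0 then 1 else ‖(Complex.Gamma β)⁻¹‖ * Real.Gamma β.re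

theorem norm_betaIntegral_le (α β : ℂ) (hα : 0 < α.re) (hβ : 0 < β.re) :
    ‖Complex.betaIntegral α β‖ * Real.Gamma (α.re + β.re) ≤
      Real.Gamma α.re * Real.Gamma β.re := by
  have hre := Complex.Gamma_mul_Gamma_eq_betaIntegral (s := (α.re : ℂ)) (t := (β.re : ℂ))
    (by simpa using hα) (by simpa using hβ)
  set b : ℝ := ∫ w in (0 : ℝ)..1, w ^ (α.re - 1) * (1 - w) ^ (β.re - 1) with hb
  have hreal : Complex.betaIntegral (α.re : ℂ) (β.re : ℂ) = (b : ℂ) := by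
    rw [Complex.betaIntegral, hb, ← intervalIntegral.integral_ofReal]
    refine intervalIntegral.integral_congr fun w hw => ?_
    rw [uIcc_of_le zero_le_one] at hw
    push_cast [Complex.ofReal_cpow hw.1, Complex.ofReal_cpow (sub_nonneg.2 hw.2)]
    rfl
  have hle : ‖Complex.betaIntegral α β‖ ≤ b := by
    rw [Complex.betaIntegral, hb, intervalIntegral.integral_of_le zero_le_one,
      intervalIntegral.integral_of_le zero_le_one, integral_Ioc_eq_integral_Ioo,
      integral_Ioc_eq_integral_Ioo]
    refine (norm_integral_le_integral_norm _).trans_eq ?_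
    refine setIntegral_congr_fun measurableSet_Ioo fun w hw => ?_
    have h1 : (1 : ℂ) - (w : ℂ) = ((1 - w : ℝ) : ℂ) := by push_cast; rfl
    simp only [norm_mul]
    rw [h1, Complex.norm_cpow_eq_rpow_re_of_pos hw.1,
      Complex.norm_cpow_eq_rpow_re_of_pos (sub_pos.2 hw.2)]
    simp
  rw [hreal, ← Complex.ofReal_add, Complex.Gamma_ofReal, Complex.Gamma_ofReal,
    Complex.Gamma_ofReal] at hre
  have hre' : Real.Gamma α.re * Real.Gamma β.re = Real.Gamma (α.re + β.re) * b := by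
    exact_mod_cast hre
  rw [hre', mul_comm]
  gcongr

theorem gammaRatio_nonneg {β : ℂ} (hβ : β = 0 ∨ 0 < β.re) : 0 ≤ gammaRatio β := by
  unfold gammaRatio
  split_ifs with h
  · exact zero_le_one
  · have := Real.Gamma_pos_of_pos (hβ.resolve_left h)
    positivity

theorem add_eq_zero_or_re_pos {α β : ℂ} (hα : α = 0 ∨ 0 < α.re) (hβ : β = 0 ∨ 0 < β.re) :
    α + β = 0 ∨ 0 < (α + β).re := by
  rcases hα with rfl | hα <;> rcases hβ with rfl | hβ
  · simp
  · simp [hβ]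
  · simp [hα]
  · right
    simpa using add_pos hα hβ

/-- Submultiplicativity of `Γ(Re β) / |Γ(β)|`, from `|B(α, β)| ≤ B(Re α, Re β)`. It replaces
Stirling's formula for complex arguments. -/
theorem gammaRatio_add_le {α β : ℂ} (hα : α = 0 ∨ 0 < α.re) (hβ : β = 0 ∨ 0 < β.re) :
    gammaRatio (α + β) ≤ gammaRatio α * gammaRatio β := by
  rcases hα with rfl | hα
  · simp [gammaRatio]
  rcases hβ with rfl | hβ
  · simp [gammaRatio]
  have hα0 : α ≠ 0 := by rintro rfl; simp at hα
  have hβ0 : β ≠ 0 := by rintro rfl; simp at hβ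
  have hs : 0 < (α + β).re := by simpa using add_pos hα hβ
  have hs0 : α + β ≠ 0 := by intro h; rw [h] at hs; simp at hs
  simp only [gammaRatio, hα0, hβ0, hs0, if_false]
  have hB := Complex.Gamma_mul_Gamma_eq_betaIntegral hα hβ
  have hN := norm_betaIntegral_le α β hα hβ
  have e := congrArg norm hB
  rw [norm_mul, norm_mul] at e
  have g1 : 0 < ‖Complex.Gamma α‖ := norm_pos_iff.2 (Complex.Gamma_ne_zero_of_re_pos hα)
  have g2 : 0 < ‖Complex.Gamma β‖ := norm_pos_iff.2 (Complex.Gamma_ne_zero_of_re_pos hβ)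
  have g3 : 0 < ‖Complex.Gamma (α + β)‖ := norm_pos_iff.2 (Complex.Gamma_ne_zero_of_re_pos hs)
  rw [norm_inv, norm_inv, norm_inv, Complex.add_re]
  rw [inv_mul_eq_div, inv_mul_eq_div, inv_mul_eq_div, div_mul_div_comm, e,
    div_le_div_iff₀ g3 (by rw [← e]; positivity)]
  nlinarith [mul_le_mul_of_nonneg_left hN g3.le]

theorem gammaRatio_nat_mul_le {β : ℂ} (hβ : 0 < β.re) (n : ℕ) :
    ((n : ℂ) * β = 0 ∨ 0 < ((n : ℂ) * β).re) ∧
      gammaRatio ((n : ℂ) * β) ≤ gammaRatio β ^ n := by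
  induction n with
  | zero => simp [gammaRatio]
  | succ n ih =>
    have e : ((n + 1 : ℕ) : ℂ) * β = (n : ℂ) * β + β := by push_cast; ring
    rw [e, pow_succ]
    exact ⟨add_eq_zero_or_re_pos ih.1 (Or.inr hβ),
      (gammaRatio_add_le ih.1 (Or.inr hβ)).trans
        (mul_le_mul_of_nonneg_right ih.2 (gammaRatio_nonneg (Or.inr hβ)))⟩

theorem gammaRatio_sum_le {ι : Type*} (S : Finset ι) {ν : ι → ℂ} (hν : ∀ i, 0 < (ν i).re)
    (r : ι → ℕ) :
    ((∑ i ∈ S, (r i : ℂ) * ν i) = 0 ∨ 0 < (∑ i ∈ S, (r i : ℂ) * ν i).re) ∧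
      gammaRatio (∑ i ∈ S, (r i : ℂ) * ν i) ≤ ∏ i ∈ S, gammaRatio (ν i) ^ r i := by
  classical
  induction S using Finset.induction_on with
  | empty => simp [gammaRatio]
  | insert i S hi ih =>
    have h := gammaRatio_nat_mul_le (hν i) (r i)
    rw [Finset.sum_insert hi, Finset.prod_insert hi]
    exact ⟨add_eq_zero_or_re_pos h.1 ih.1, (gammaRatio_add_le h.1 ih.1).trans
      (mul_le_mul h.2 ih.2 (gammaRatio_nonneg ih.1)
        (pow_nonneg (gammaRatio_nonneg (Or.inr (hν i))) _))⟩

/-! ### Riemann–Liouville kernels and their semigroup law -/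

/-- The kernel `u ^ (β - 1) / Γ(β)` of the Riemann–Liouville integral of order `β`, extended by
`0` to `u ≤ 0`. At `β = 0` it is the zero function, since Mathlib puts `Γ(0) = 0`. -/
noncomputable def rlKernel (β : ℂ) (u : ℝ) : ℂ :=
  if 0 < u then (u : ℂ) ^ (β - 1) * (Complex.Gamma β)⁻¹ else 0

theorem rlKernel_of_pos (β : ℂ) {u : ℝ} (hu : 0 < u) :
    rlKernel β u = (u : ℂ) ^ (β - 1) * (Complex.Gamma β)⁻¹ := if_pos hu

theorem rlKernel_of_nonpos (β : ℂ) {u : ℝ} (hu : u ≤ 0) : rlKernel β u = 0 :=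
  if_neg hu.not_gt

@[simp] theorem rlKernel_zero (u : ℝ) : rlKernel 0 u = 0 := by
  simp [rlKernel, Complex.Gamma_zero]

theorem norm_rlKernel (β : ℂ) {u : ℝ} (hu : 0 < u) :
    ‖rlKernel β u‖ = u ^ (β.re - 1) * ‖(Complex.Gamma β)⁻¹‖ := by
  rw [rlKernel_of_pos β hu, norm_mul, Complex.norm_cpow_eq_rpow_re_of_pos hu]
  simp

theorem measurable_rlKernel (β : ℂ) : Measurable (rlKernel β) := by
  unfold rlKernel
  refine Measurable.ite measurableSet_Ioi ?_ measurable_const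
  exact (Complex.measurable_ofReal.pow_const _).mul_const _

/-- The semigroup law `g_α * g_β = g_{α + β}`, from the Beta integral. -/
theorem rlKernel_conv {α β : ℂ} (hα : 0 < α.re) (hβ : 0 < β.re) {t : ℝ} (ht : 0 < t) :
    ∫ w in Ioo 0 t, rlKernel α (t - w) * rlKernel β w = rlKernel (α + β) t := by
  have h := Complex.betaIntegral_scaled β α ht
  rw [intervalIntegral.integral_of_le ht.le, integral_Ioc_eq_integral_Ioo] at h
  have hs : 0 < (β + α).re := by simpa using add_pos hβ hα
  have hB := Complex.Gamma_mul_Gamma_eq_betaIntegral hβ hα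
  have n1 := Complex.Gamma_ne_zero_of_re_pos hα
  have n2 := Complex.Gamma_ne_zero_of_re_pos hβ
  have n3 := Complex.Gamma_ne_zero_of_re_pos hs
  calc ∫ w in Ioo 0 t, rlKernel α (t - w) * rlKernel β w
      = ∫ w in Ioo 0 t, ((w : ℂ) ^ (β - 1) * ((t : ℂ) - w) ^ (α - 1)) *
          ((Complex.Gamma α)⁻¹ * (Complex.Gamma β)⁻¹) := by
        refine setIntegral_congr_fun measurableSet_Ioo fun w hw => ?_
        simp only [rlKernel_of_pos α (sub_pos.2 hw.2), rlKernel_of_pos β hw.1]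
        push_cast
        ring
    _ = rlKernel (α + β) t := by
        rw [integral_mul_const, h, rlKernel_of_pos _ ht, add_comm α β]
        field_simp
        linear_combination (-(t : ℂ) ^ (β + α - 1)) * hB

/-! ### The multi-index expansion of the resolvent kernel -/

section Series

variable {ι : Type*} [Fintype ι]

/-- The order `∑ rᵢ νᵢ` attached to a multi-index `r`. -/
noncomputable def weight (ν : ι → ℂ) (r : ι → ℕ) : ℂ := ∑ i, (r i : ℂ) * ν i

/-- The coefficient `(-1) ^ |r| |r|! / ∏ rᵢ! ∏ aᵢ ^ rᵢ` of the `r`-th kernel. -/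
noncomputable def coeff (a : ι → ℂ) (r : ι → ℕ) : ℂ :=
  (-1) ^ (∑ i, r i) * (Nat.multinomial Finset.univ r : ℂ) * ∏ i, a i ^ r i

theorem weight_zero (ν : ι → ℂ) : weight ν 0 = 0 := by simp [weight]

theorem coeff_zero (a : ι → ℂ) : coeff a 0 = 1 := by
  simp [coeff, Nat.multinomial]

theorem weight_re (ν : ι → ℂ) (r : ι → ℕ) : (weight ν r).re = ∑ i, (r i : ℝ) * (ν i).re := by
  simp [weight]

theorem summable_multinomial_mul_prod_pow {D : ι → ℝ} (hD : ∀ i, 0 ≤ D i)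
    (h : ∑ i, D i < 1) :
    Summable fun r : ι → ℕ => (Nat.multinomial Finset.univ r : ℝ) * ∏ i, D i ^ r i := by
  classical
  have h0 : 0 ≤ ∑ i, D i := Finset.sum_nonneg fun i _ => hD i
  have hnn : ∀ r : ι → ℕ, 0 ≤ (Nat.multinomial Finset.univ r : ℝ) * ∏ i, D i ^ r i :=
    fun r => mul_nonneg (Nat.cast_nonneg _) (Finset.prod_nonneg fun i _ => pow_nonneg (hD i) _)
  refine summable_of_sum_le (c := ∑' n : ℕ, (∑ i, D i) ^ n) hnn fun S => ?_
  calc ∑ r ∈ S, (Nat.multinomial Finset.univ r : ℝ) * ∏ i, D i ^ r i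
      = ∑ n ∈ S.image (fun r => ∑ i, r i), ∑ r ∈ S with ∑ i, r i = n,
          (Nat.multinomial Finset.univ r : ℝ) * ∏ i, D i ^ r i :=
        (Finset.sum_fiberwise_of_maps_to (fun r hr => Finset.mem_image_of_mem _ hr) _).symm
    _ ≤ ∑ n ∈ S.image (fun r => ∑ i, r i), (∑ i, D i) ^ n := by
        refine Finset.sum_le_sum fun n _ => ?_
        rw [Finset.sum_pow_eq_sum_piAntidiag]
        refine Finset.sum_le_sum_of_subset_of_nonneg (fun r hr => ?_) fun r _ _ => hnn r
        simp only [Finset.mem_filter] at hr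
        simp [Finset.mem_piAntidiag, hr.2]
    _ ≤ ∑' n : ℕ, (∑ i, D i) ^ n :=
        (summable_geometric_of_lt_one h0 h).sum_le_tsum _ fun n _ => pow_nonneg h0 n

/-- The domination used throughout: on `(0, T]` the terms of the resolvent series are bounded by
a summable sequence, which does not depend on the exponent `η`, times `T ^ (-η) u ^ (η - 1)`, for
every `η` below the real part of the order. -/
theorem exists_summable_bound (a ν : ι → ℂ) (hν : ∀ i, 0 < (ν i).re) {T : ℝ} (hT : 0 < T) :
    ∃ B : (ι → ℕ) → ℝ, Summable B ∧ (∀ r, 0 ≤ B r) ∧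
      ∀ (r : ι → ℕ) (η u : ℝ), η ≤ (weight ν r).re → 0 < u → u ≤ T →
        ‖coeff a r * rlKernel (weight ν r) u‖ ≤ B r * (T ^ (-η) * u ^ (η - 1)) := by
  have hR : ∀ i, 0 ≤ gammaRatio (ν i) := fun i => gammaRatio_nonneg (Or.inr (hν i))
  obtain ⟨q, hq, hqs⟩ : ∃ q : ℝ, 0 < q ∧
      ∑ i, ‖a i‖ * gammaRatio (ν i) * (q * T) ^ (ν i).re < 1 := by
    have hc : Continuous fun q : ℝ => ∑ i, ‖a i‖ * gammaRatio (ν i) * (q * T) ^ (ν i).re := by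
      refine continuous_finsetSum _ fun i _ => continuous_const.mul ?_
      exact (continuous_mul_const T).rpow_const fun _ => Or.inr (hν i).le
    have h0 : ∑ i, ‖a i‖ * gammaRatio (ν i) * ((0 : ℝ) * T) ^ (ν i).re < 1 := by
      simp [Real.zero_rpow (hν _).ne']
    have he := (hc.tendsto 0).eventually (gt_mem_nhds h0)
    obtain ⟨q, hq1, hq2⟩ :=
      ((he.filter_mono nhdsWithin_le_nhds).and (self_mem_nhdsWithin (s := Ioi (0 : ℝ)))).exists
    exact ⟨q, hq2, hq1⟩
  obtain ⟨C, hC, hG⟩ := exists_inv_Gamma_le hq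
  set D : ι → ℝ := fun i => ‖a i‖ * gammaRatio (ν i) * (q * T) ^ (ν i).re with hD
  have hD0 : ∀ i, 0 ≤ D i := fun i => by
    have := hR i
    simp only [hD]
    positivity
  have hB0 : ∀ r : ι → ℕ, 0 ≤ C * ((Nat.multinomial Finset.univ r : ℝ) * ∏ i, D i ^ r i) :=
    fun r => by
      have : 0 ≤ ∏ i, D i ^ r i := Finset.prod_nonneg fun i _ => pow_nonneg (hD0 i) _
      positivity
  refine ⟨_, (summable_multinomial_mul_prod_pow hD0 hqs).mul_left C, hB0,
    fun r η u hη hu huT => ?_⟩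
  set w := weight ν r with hw
  have hsum := gammaRatio_sum_le Finset.univ hν r
  change (w = 0 ∨ 0 < w.re) ∧ gammaRatio w ≤ _ at hsum
  rcases eq_or_ne w 0 with h0 | h0
  · rw [h0, rlKernel_zero, mul_zero, norm_zero]
    have := hB0 r
    positivity
  have hwre : 0 < w.re := hsum.1.resolve_left h0
  have hGpos := Real.Gamma_pos_of_pos hwre
  have h1 : ‖(Complex.Gamma w)⁻¹‖ ≤ (∏ i, gammaRatio (ν i) ^ r i) * (C * q ^ w.re) := by
    have e : ‖(Complex.Gamma w)⁻¹‖ = gammaRatio w * (Real.Gamma w.re)⁻¹ := by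
      rw [gammaRatio, if_neg h0, mul_inv_cancel_right₀ hGpos.ne']
    rw [e]
    exact mul_le_mul hsum.2 (hG _ hwre) (inv_nonneg.2 hGpos.le)
      (Finset.prod_nonneg fun i _ => pow_nonneg (hR i) _)
  have h2 : u ^ (w.re - 1) ≤ T ^ w.re * (T ^ (-η) * u ^ (η - 1)) := by
    have h3 : (u / T) ^ w.re ≤ (u / T) ^ η :=
      Real.rpow_le_rpow_of_exponent_ge (by positivity) ((div_le_one hT).2 huT) hη
    rw [Real.div_rpow hu.le hT.le, Real.div_rpow hu.le hT.le,
      div_le_iff₀ (by positivity)] at h3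
    rw [Real.rpow_sub_one hu.ne', Real.rpow_sub_one hu.ne', Real.rpow_neg hT.le]
    calc u ^ w.re / u ≤ (u ^ η / T ^ η * T ^ w.re) / u := by gcongr
      _ = _ := by ring
  have h4 : q ^ w.re * T ^ w.re = ∏ i, ((q * T) ^ (ν i).re) ^ r i := by
    rw [← Real.mul_rpow hq.le hT.le, hw, weight_re, Real.rpow_sum_of_pos (by positivity)]
    refine Finset.prod_congr rfl fun i _ => ?_
    rw [mul_comm (r i : ℝ), Real.rpow_mul_natCast (by positivity)]
  have h5 : ‖coeff a r‖ = (Nat.multinomial Finset.univ r : ℝ) * ∏ i, ‖a i‖ ^ r i := by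
    simp [coeff]
  have hprod : ∏ i, D i ^ r i = (∏ i, ‖a i‖ ^ r i) * (∏ i, gammaRatio (ν i) ^ r i) *
      ∏ i, ((q * T) ^ (ν i).re) ^ r i := by
    simp only [hD, mul_pow, Finset.prod_mul_distrib]
  rw [norm_mul, norm_rlKernel _ hu, h5, hprod, ← h4]
  calc (Nat.multinomial Finset.univ r : ℝ) * (∏ i, ‖a i‖ ^ r i) *
        (u ^ (w.re - 1) * ‖(Complex.Gamma w)⁻¹‖)
      ≤ (Nat.multinomial Finset.univ r : ℝ) * (∏ i, ‖a i‖ ^ r i) *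
        ((T ^ w.re * (T ^ (-η) * u ^ (η - 1))) *
          ((∏ i, gammaRatio (ν i) ^ r i) * (C * q ^ w.re))) := by
        have : 0 ≤ ∏ i, ‖a i‖ ^ r i := Finset.prod_nonneg fun i _ => by positivity
        gcongr
    _ = _ := by ring

/-- The resolvent kernel `H`: the sum over all multi-indices, in which `r = 0` contributes `0`
because `rlKernel 0 = 0`. -/
noncomputable def resolvent (a ν : ι → ℂ) (u : ℝ) : ℂ :=
  ∑' r : ι → ℕ, coeff a r * rlKernel (weight ν r) u

theorem summable_norm_resolvent (a : ι → ℂ) {ν : ι → ℂ} (hν : ∀ i, 0 < (ν i).re) (u : ℝ) :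
    Summable fun r : ι → ℕ => ‖coeff a r * rlKernel (weight ν r) u‖ := by
  rcases le_or_gt u 0 with hu | hu
  · simp [rlKernel_of_nonpos _ hu, summable_zero]
  obtain ⟨B, hB, hB0, h⟩ := exists_summable_bound a ν hν hu
  refine Summable.of_nonneg_of_le (fun _ => norm_nonneg _) (fun r => h r 0 u ?_ hu le_rfl)
    (hB.mul_right _)
  rw [weight_re]
  exact Finset.sum_nonneg fun i _ => mul_nonneg (Nat.cast_nonneg _) (hν i).le

theorem hasSum_resolvent (a : ι → ℂ) {ν : ι → ℂ} (hν : ∀ i, 0 < (ν i).re) (u : ℝ) :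
    HasSum (fun r : ι → ℕ => coeff a r * rlKernel (weight ν r) u) (resolvent a ν u) :=
  (summable_norm_resolvent a hν u).of_norm.hasSum

theorem measurable_resolvent (a : ι → ℂ) {ν : ι → ℂ} (hν : ∀ i, 0 < (ν i).re) :
    Measurable (resolvent a ν) :=
  measurable_of_tendsto_metrizable'
    (f := fun (S : Finset (ι → ℕ)) u => ∑ r ∈ S, coeff a r * rlKernel (weight ν r) u)
    Filter.atTop
    (fun S => Finset.measurable_fun_sum S fun _ _ => (measurable_rlKernel _).const_mul _)
    (tendsto_pi_nhds.2 fun u => hasSum_resolvent a hν u)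

theorem resolvent_of_nonpos (a ν : ι → ℂ) {u : ℝ} (hu : u ≤ 0) : resolvent a ν u = 0 := by
  simp [resolvent, rlKernel_of_nonpos _ hu]

theorem le_weight_re {ν : ι → ℂ} {ξ : ℝ}
    (hξ : ∀ i, ξ ≤ (ν i).re) (r : ι → ℕ) :
    ((∑ i, r i : ℕ) : ℝ) * ξ ≤ (weight ν r).re := by
  rw [weight_re, Nat.cast_sum, Finset.sum_mul]
  exact Finset.sum_le_sum fun i _ => mul_le_mul_of_nonneg_left (hξ i) (Nat.cast_nonneg _)

theorem eq_zero_or_le_weight_re {ν : ι → ℂ} {ξ : ℝ} (hξ0 : 0 ≤ ξ)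
    (hξ : ∀ i, ξ ≤ (ν i).re) (r : ι → ℕ) : r = 0 ∨ ξ ≤ (weight ν r).re := by
  rcases Nat.eq_zero_or_pos (∑ i, r i) with h | h
  · left
    ext i
    exact (Finset.sum_eq_zero_iff.1 h) i (Finset.mem_univ i)
  · right
    refine le_trans ?_ (le_weight_re hξ r)
    have : (1 : ℝ) ≤ ((∑ i, r i : ℕ) : ℝ) := by exact_mod_cast h
    nlinarith

/-- The domination of `exists_summable_bound` at `η = ξ`, where it covers `r = 0` as well. -/
theorem norm_coeff_mul_rlKernel_le {a ν : ι → ℂ} {ξ : ℝ} (hξ0 : 0 < ξ)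
    (hξ : ∀ i, ξ ≤ (ν i).re) {T : ℝ} (hT : 0 < T) :
    ∃ B : (ι → ℕ) → ℝ, Summable B ∧ (∀ r, 0 ≤ B r) ∧
      ∀ (r : ι → ℕ) (u : ℝ), 0 < u → u ≤ T →
        ‖coeff a r * rlKernel (weight ν r) u‖ ≤ B r * u ^ (ξ - 1) := by
  obtain ⟨B, hB, hB0, h⟩ := exists_summable_bound a ν (fun i => hξ0.trans_le (hξ i)) hT
  refine ⟨fun r => B r * T ^ (-ξ), hB.mul_right _, fun r => mul_nonneg (hB0 r) (by positivity),
    fun r u hu huT => ?_⟩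
  rcases eq_zero_or_le_weight_re hξ0.le hξ r with rfl | hr
  · have := hB0 0
    rw [weight_zero, rlKernel_zero, mul_zero, norm_zero]
    positivity
  · simpa [mul_assoc] using h r ξ u hr hu huT

theorem exists_norm_resolvent_le (a : ι → ℂ) {ν : ι → ℂ} {ξ : ℝ} (hξ0 : 0 < ξ)
    (hξ : ∀ i, ξ ≤ (ν i).re) {T : ℝ} (hT : 0 < T) :
    ∃ C : ℝ, 0 ≤ C ∧ ∀ u : ℝ, 0 < u → u ≤ T → ‖resolvent a ν u‖ ≤ C * u ^ (ξ - 1) := by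
  obtain ⟨B, hB, hB0, h⟩ := norm_coeff_mul_rlKernel_le (a := a) hξ0 hξ hT
  exact ⟨∑' r, B r, tsum_nonneg hB0, fun u hu huT =>
    tsum_of_norm_bounded (hB.hasSum.mul_right _) fun r => h r u hu huT⟩

/-- Pascal's rule for multinomial coefficients, in multiplied-out form. -/
theorem succ_mul_multinomial_add_single [DecidableEq ι] (r : ι → ℕ) (i : ι) :
    (r i + 1) * Nat.multinomial Finset.univ (r + Pi.single i 1) =
      ((∑ j, r j) + 1) * Nat.multinomial Finset.univ r := by
  have h1 := Nat.multinomial_spec Finset.univ (r + Pi.single i 1)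
  have h2 := Nat.multinomial_spec Finset.univ r
  have hs : ∑ j, (r + Pi.single i 1 : ι → ℕ) j = (∑ j, r j) + 1 := by
    simp [Finset.sum_add_distrib]
  have hp : ∏ j, ((r + Pi.single i 1 : ι → ℕ) j).factorial = (r i + 1) * ∏ j, (r j).factorial := by
    rw [Fintype.prod_eq_mul_prod_compl i, Fintype.prod_eq_mul_prod_compl i, ← mul_assoc]
    congr 1
    · simp [Nat.factorial_succ]
    · refine Finset.prod_congr rfl fun j hj => ?_
      have : j ≠ i := by simpa using hj
      simp [this]
  rw [hs, hp, Nat.factorial_succ, ← h2] at h1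
  have hpos : 0 < ∏ j, (r j).factorial := Finset.prod_pos fun j _ => Nat.factorial_pos _
  refine Nat.eq_of_mul_eq_mul_left hpos ?_
  linarith

/-- The recursion of the coefficients behind the resolvent equation: raising the `i`-th index
multiplies by `-aᵢ (|r| + 1) / (rᵢ + 1)`. -/
theorem mul_coeff_mul_succ [DecidableEq ι] (a : ι → ℂ) (r : ι → ℕ) (i : ι) :
    a i * coeff a r * (((∑ j, r j : ℕ) : ℂ) + 1) =
      -((r i : ℂ) + 1) * coeff a (r + Pi.single i 1) := by
  have hm : ((r i : ℂ) + 1) * (Nat.multinomial Finset.univ (r + Pi.single i 1) : ℂ) =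
      (((∑ j, r j : ℕ) : ℂ) + 1) * (Nat.multinomial Finset.univ r : ℂ) := by
    exact_mod_cast congrArg (Nat.cast : ℕ → ℂ) (succ_mul_multinomial_add_single r i)
  have hs : ∑ j, (r + Pi.single i 1 : ι → ℕ) j = (∑ j, r j) + 1 := by
    simp [Finset.sum_add_distrib]
  have hp : ∏ j, a j ^ (r + Pi.single i 1 : ι → ℕ) j = a i * ∏ j, a j ^ r j := by
    rw [Fintype.prod_eq_mul_prod_compl i, Fintype.prod_eq_mul_prod_compl i, ← mul_assoc]
    congr 1
    · simp [pow_succ']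
    · refine Finset.prod_congr rfl fun j hj => ?_
      have : j ≠ i := by simpa using hj
      simp [this]
  rw [coeff, coeff, hs, hp, pow_succ]
  linear_combination (-(-1) ^ (∑ j, r j) * a i * ∏ j, a j ^ r j) * hm

theorem weight_add_single [DecidableEq ι] (ν : ι → ℂ) (r : ι → ℕ) (i : ι) :
    weight ν (r + Pi.single i 1) = ν i + weight ν r := by
  simp [weight, add_mul, Finset.sum_add_distrib, Pi.single_apply, add_comm]

/-! ### The resolvent equation for the kernel -/

theorem integrableOn_rpow_mul_rpow_sub {x y : ℝ} (hx : 0 < x) (hy : 0 < y) {t : ℝ}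
    (ht : 0 < t) :
    IntegrableOn (fun w : ℝ => (t - w) ^ (y - 1) * w ^ (x - 1)) (Ioo 0 t) :=
  (integrableOn_rpow_mul_rpow hx hy ht).congr_fun (fun _ _ => mul_comm _ _) measurableSet_Ioo

theorem integrableOn_rlKernel_mul {α : ℂ} (hα : 0 < α.re) {ξ : ℝ} (hξ : 0 < ξ) {t : ℝ}
    (ht : 0 < t) {k : ℝ → ℂ} (hk : Measurable k) {C : ℝ}
    (hC : ∀ u, 0 < u → u ≤ t → ‖k u‖ ≤ C * u ^ (ξ - 1)) :
    IntegrableOn (fun w => rlKernel α (t - w) * k w) (Ioo 0 t) := by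
  refine Integrable.mono' ((integrableOn_rpow_mul_rpow_sub hξ hα ht).const_mul
    (‖(Complex.Gamma α)⁻¹‖ * C)) ?_ ?_
  · exact (((measurable_rlKernel α).comp (measurable_const.sub measurable_id)).mul
      hk).aestronglyMeasurable
  · filter_upwards [ae_restrict_mem measurableSet_Ioo] with w hw
    have hw' : 0 < t - w := sub_pos.2 hw.2
    rw [norm_mul, norm_rlKernel _ hw']
    calc (t - w) ^ (α.re - 1) * ‖(Complex.Gamma α)⁻¹‖ * ‖k w‖
        ≤ (t - w) ^ (α.re - 1) * ‖(Complex.Gamma α)⁻¹‖ * (C * w ^ (ξ - 1)) := by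
          have := hC w hw.1 hw.2.le
          have := hw'.le
          gcongr
      _ = _ := by ring

/-- Convolving the resolvent series termwise with the kernel of order `νᵢ` shifts every order by
`νᵢ`; the separate summand `rlKernel (ν i) u` is what the Dirac mass at `r = 0` would give. -/
theorem hasSum_rlKernel_conv_resolvent (a : ι → ℂ) {ν : ι → ℂ} {ξ : ℝ} (hξ0 : 0 < ξ)
    (hξ : ∀ i, ξ ≤ (ν i).re) (i : ι) {u : ℝ} (hu : 0 < u) :
    HasSum (fun r : ι → ℕ => coeff a r * rlKernel (ν i + weight ν r) u)
      (rlKernel (ν i) u + ∫ w in Ioo 0 u, rlKernel (ν i) (u - w) * resolvent a ν w) := by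
  classical
  have hν : ∀ i, 0 < (ν i).re := fun i => hξ0.trans_le (hξ i)
  obtain ⟨B, hB, hB0, hBb⟩ := norm_coeff_mul_rlKernel_le (a := a) hξ0 hξ hu
  have hterm : ∀ r : ι → ℕ, Measurable fun w => coeff a r * rlKernel (weight ν r) w :=
    fun r => (measurable_rlKernel _).const_mul _
  have hint : ∀ r : ι → ℕ, IntegrableOn
      (fun w => rlKernel (ν i) (u - w) * (coeff a r * rlKernel (weight ν r) w)) (Ioo 0 u) :=
    fun r => integrableOn_rlKernel_mul (hν i) hξ0 hu (hterm r) (hBb r)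
  set K : ℝ := ∫ w in Ioo 0 u, ‖(Complex.Gamma (ν i))⁻¹‖ *
    ((u - w) ^ ((ν i).re - 1) * w ^ (ξ - 1)) with hK
  have hs : Summable fun r : ι → ℕ => ∫ w in Ioo 0 u,
      ‖rlKernel (ν i) (u - w) * (coeff a r * rlKernel (weight ν r) w)‖ := by
    refine Summable.of_nonneg_of_le (fun _ => integral_nonneg fun _ => norm_nonneg _)
      (fun r => ?_) (hB.mul_right K)
    rw [hK, ← integral_const_mul]
    refine setIntegral_mono_on (hint r).norm
      (((integrableOn_rpow_mul_rpow_sub hξ0 (hν i) hu).const_mul _).const_mul _)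
      measurableSet_Ioo fun w hw => ?_
    have hw' : 0 < u - w := sub_pos.2 hw.2
    rw [norm_mul, norm_rlKernel _ hw']
    calc (u - w) ^ ((ν i).re - 1) * ‖(Complex.Gamma (ν i))⁻¹‖ * _
        ≤ (u - w) ^ ((ν i).re - 1) * ‖(Complex.Gamma (ν i))⁻¹‖ * (B r * w ^ (ξ - 1)) := by
          have := hBb r w hw.1 hw.2.le
          have := hw'.le
          gcongr
      _ = _ := by ring
  have hsum := hasSum_integral_of_summable_integral_norm hint hs
  have hR : ∫ w in Ioo 0 u, ∑' r : ι → ℕ,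
      rlKernel (ν i) (u - w) * (coeff a r * rlKernel (weight ν r) w) =
      ∫ w in Ioo 0 u, rlKernel (ν i) (u - w) * resolvent a ν w := by
    simp only [tsum_mul_left, resolvent]
  rw [hR] at hsum
  have h0 : HasSum (fun r : ι → ℕ => if r = 0 then rlKernel (ν i) u else 0)
      (rlKernel (ν i) u) := hasSum_ite_eq 0 _
  refine (h0.add hsum).congr_fun fun r => ?_
  rcases eq_zero_or_le_weight_re hξ0.le hξ r with rfl | hr
  · simp [weight_zero, coeff_zero]
  · have hr0 : r ≠ 0 := by
      rintro rfl
      rw [weight_zero] at hr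
      simp only [Complex.zero_re] at hr
      linarith
    rw [if_neg hr0, zero_add, ← rlKernel_conv (hν i) (hξ0.trans_le hr) hu, ← integral_const_mul]
    refine integral_congr_ae (Filter.Eventually.of_forall fun w => ?_)
    simp only
    ring

/-- The resolvent equation `H = -∑ aᵢ (gᵢ + gᵢ * H)` for the kernels `gᵢ = rlKernel (ν i)`. -/
theorem resolvent_eq (a : ι → ℂ) {ν : ι → ℂ} {ξ : ℝ} (hξ0 : 0 < ξ)
    (hξ : ∀ i, ξ ≤ (ν i).re) {u : ℝ} (hu : 0 < u) :
    resolvent a ν u = -∑ i, a i * (rlKernel (ν i) u +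
      ∫ w in Ioo 0 u, rlKernel (ν i) (u - w) * resolvent a ν w) := by
  classical
  have hν : ∀ i, 0 < (ν i).re := fun i => hξ0.trans_le (hξ i)
  -- Reindexing by `r ↦ r + eᵢ` distributes the `r`-th term of `H` over `i` in proportion to `rᵢ`.
  have key : ∀ i, HasSum (fun r : ι → ℕ =>
      -((r i : ℂ) / ((∑ j, r j : ℕ) : ℂ)) * (coeff a r * rlKernel (weight ν r) u))
      (a i * (rlKernel (ν i) u +
        ∫ w in Ioo 0 u, rlKernel (ν i) (u - w) * resolvent a ν w)) := by
    intro i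
    have hinj : Function.Injective fun r : ι → ℕ => r + Pi.single i 1 :=
      add_left_injective _
    rw [← hinj.hasSum_iff]
    · refine ((hasSum_rlKernel_conv_resolvent a hξ0 hξ i hu).mul_left (a i)).congr_fun fun r => ?_
      have hc := mul_coeff_mul_succ a r i
      have hne : (((∑ j, r j : ℕ) : ℂ) + 1) ≠ 0 := Nat.cast_add_one_ne_zero _
      have hs : ∑ j, (r + Pi.single i 1 : ι → ℕ) j = (∑ j, r j) + 1 := by
        simp [Finset.sum_add_distrib]
      simp only [Function.comp_apply]
      rw [hs, weight_add_single, Pi.add_apply, Pi.single_eq_same, Nat.cast_add, Nat.cast_add,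
        Nat.cast_one]
      field_simp
      linear_combination (-rlKernel (ν i + weight ν r) u) * hc
    · intro r hr
      have : r i = 0 := by
        by_contra h
        refine hr ⟨r - Pi.single i 1, ?_⟩
        ext j
        by_cases hj : j = i
        · subst hj
          simp
          omega
        · simp [hj]
      simp [this]
  have hS := (hasSum_sum fun i (_ : i ∈ Finset.univ) => key i).neg
  refine (hasSum_resolvent a hν u).unique (hS.congr_fun fun r => ?_)
  rcases eq_or_ne r 0 with rfl | hr
  · simp [weight_zero]
  have hne : ((∑ j, r j : ℕ) : ℂ) ≠ 0 := by
    rw [Nat.cast_ne_zero]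
    intro h
    exact hr (funext fun i => (Finset.sum_eq_zero_iff.1 h) i (Finset.mem_univ i))
  rw [← Finset.sum_mul, Finset.sum_neg_distrib, ← Finset.sum_div, ← Nat.cast_sum, div_self hne]
  ring

end Series

/-! ### Convolution with an integrable function at a given time -/

theorem integral_rpow_mul_rpow_sub {x y : ℝ} {s : ℝ} (hs : 0 < s) :
    ∫ w in Ioo 0 s, (s - w) ^ (y - 1) * w ^ (x - 1) =
      ‖Complex.betaIntegral x y‖ * s ^ (x + y - 1) := by
  have h := Complex.betaIntegral_scaled x y hs
  rw [intervalIntegral.integral_of_le hs.le, integral_Ioc_eq_integral_Ioo] at h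
  have e : ∫ w in Ioo 0 s, (w : ℂ) ^ ((x : ℂ) - 1) * ((s : ℂ) - w) ^ ((y : ℂ) - 1) =
      ((∫ w in Ioo 0 s, (s - w) ^ (y - 1) * w ^ (x - 1) : ℝ) : ℂ) := by
    rw [← integral_complex_ofReal]
    refine setIntegral_congr_fun measurableSet_Ioo fun w hw => ?_
    push_cast [Complex.ofReal_cpow hw.1.le, Complex.ofReal_cpow (sub_nonneg.2 hw.2.le)]
    ring
  rw [e] at h
  have h' := congrArg norm h
  rw [norm_mul, Complex.norm_cpow_eq_rpow_re_of_pos hs, Complex.norm_real, Real.norm_of_nonneg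
    (setIntegral_nonneg measurableSet_Ioo fun w hw =>
      mul_nonneg (Real.rpow_nonneg (sub_nonneg.2 hw.2.le) _) (Real.rpow_nonneg hw.1.le _))] at h'
  rw [h', mul_comm]
  simp

/-- Times `t` at which `f` can be convolved with the power `u ^ (ξ - 1)`. -/
def IsAdmissible (f : ℝ → ℂ) (ξ t : ℝ) : Prop :=
  IntegrableOn (fun v => ‖f v‖ * (t - v) ^ (ξ - 1)) (Ioo 0 t)

theorem aestronglyMeasurable_comp_sub_mul {f : ℝ → ℂ} (hf : IntegrableOn f (Ioi 0)) {t : ℝ}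
    {k : ℝ → ℂ} (hk : Measurable k) :
    AEStronglyMeasurable (fun v => k (t - v) * f v) (volume.restrict (Ioo 0 t)) :=
  (hk.comp (measurable_const.sub measurable_id)).aestronglyMeasurable.mul
    (hf.mono_set Ioo_subset_Ioi_self).aestronglyMeasurable

theorem norm_comp_sub_mul_le {f : ℝ → ℂ} {ξ t v : ℝ} {k : ℝ → ℂ} {C : ℝ}
    (hC : ∀ u, 0 < u → u ≤ t → ‖k u‖ ≤ C * u ^ (ξ - 1)) (hv : v ∈ Ioo 0 t) :
    ‖k (t - v) * f v‖ ≤ C * (‖f v‖ * (t - v) ^ (ξ - 1)) := by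
  rw [norm_mul]
  calc ‖k (t - v)‖ * ‖f v‖ ≤ C * (t - v) ^ (ξ - 1) * ‖f v‖ := by
        have := hC (t - v) (sub_pos.2 hv.2) (by linarith [hv.1])
        gcongr
    _ = _ := by ring

theorem IsAdmissible.integrableOn_mul {f : ℝ → ℂ} (hf : IntegrableOn f (Ioi 0)) {ξ t : ℝ}
    (h : IsAdmissible f ξ t) {k : ℝ → ℂ} (hk : Measurable k) {C : ℝ}
    (hC : ∀ u, 0 < u → u ≤ t → ‖k u‖ ≤ C * u ^ (ξ - 1)) :
    IntegrableOn (fun v => k (t - v) * f v) (Ioo 0 t) := by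
  refine Integrable.mono' (h.const_mul C) (aestronglyMeasurable_comp_sub_mul hf hk) ?_
  filter_upwards [ae_restrict_mem measurableSet_Ioo] with v hv
  exact norm_comp_sub_mul_le hC hv

theorem IsAdmissible.hasSum_integral {S : Type*} [Countable S] {f : ℝ → ℂ}
    (hf : IntegrableOn f (Ioi 0)) {ξ t : ℝ} (h : IsAdmissible f ξ t) {k : S → ℝ → ℂ}
    (hk : ∀ s, Measurable (k s)) {B : S → ℝ} (hB : Summable B)
    (hC : ∀ s u, 0 < u → u ≤ t → ‖k s u‖ ≤ B s * u ^ (ξ - 1)) :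
    HasSum (fun s => ∫ v in Ioo 0 t, k s (t - v) * f v)
      (∫ v in Ioo 0 t, (∑' s, k s (t - v)) * f v) := by
  have hint := fun s => h.integrableOn_mul hf (hk s) (hC s)
  have := hasSum_integral_of_summable_integral_norm hint ?_
  · simpa only [tsum_mul_right] using this
  · refine Summable.of_nonneg_of_le (fun _ => integral_nonneg fun _ => norm_nonneg _)
      (fun s => ?_) (hB.mul_right (∫ v in Ioo 0 t, ‖f v‖ * (t - v) ^ (ξ - 1)))
    rw [← integral_const_mul]
    exact setIntegral_mono_on (hint s).norm (h.const_mul _) measurableSet_Ioo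
      fun v hv => norm_comp_sub_mul_le (hC s) hv

section Fubini

variable {f : ℝ → ℂ} {ξ t : ℝ} {α : ℂ} {k : ℝ → ℂ} {C : ℝ}

theorem support_rlKernel_mul_subset (hk0 : ∀ u ≤ 0, k u = 0) (s : ℝ) :
    Function.support (fun y => rlKernel α (s - y) * k y) ⊆ Ioo 0 s := by
  intro y hy
  rw [Function.mem_support] at hy
  constructor
  · by_contra h
    exact hy (by rw [hk0 y (not_lt.1 h), mul_zero])
  · by_contra h
    exact hy (by rw [rlKernel_of_nonpos _ (by linarith [not_lt.1 h]), zero_mul])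

theorem integrable_rlKernel_mul (hα : 0 < α.re) (hξ : 0 < ξ) (hk : Measurable k)
    (hk0 : ∀ u ≤ 0, k u = 0) {s : ℝ} (hs : 0 < s)
    (hC : ∀ u, 0 < u → u ≤ s → ‖k u‖ ≤ C * u ^ (ξ - 1)) :
    Integrable (fun y => rlKernel α (s - y) * k y) :=
  (integrableOn_iff_integrable_of_support_subset (support_rlKernel_mul_subset hk0 s)).1
    (integrableOn_rlKernel_mul hα hξ hs hk hC)

theorem integral_norm_rlKernel_mul_le (hα : 0 < α.re) (hξ : 0 < ξ) (hk : Measurable k)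
    (hk0 : ∀ u ≤ 0, k u = 0) {s : ℝ} (hs : 0 < s)
    (hC : ∀ u, 0 < u → u ≤ s → ‖k u‖ ≤ C * u ^ (ξ - 1)) :
    ∫ y, ‖rlKernel α (s - y) * k y‖ ≤
      ‖(Complex.Gamma α)⁻¹‖ * C * ‖Complex.betaIntegral ξ α.re‖ * s ^ (ξ + α.re - 1) := by
  have hsub : Function.support (fun y => ‖rlKernel α (s - y) * k y‖) ⊆ Ioo 0 s := by
    exact fun y hy => support_rlKernel_mul_subset (α := α) hk0 s
      (Function.mem_support.2 fun h => hy (norm_eq_zero.2 h))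
  rw [← setIntegral_eq_integral_of_forall_compl_eq_zero
    (fun y hy => Function.notMem_support.1 fun h => hy (hsub h)), mul_assoc,
    ← integral_rpow_mul_rpow_sub hs, ← integral_const_mul]
  refine setIntegral_mono_on (integrable_rlKernel_mul hα hξ hk hk0 hs hC).norm.integrableOn
    ((integrableOn_rpow_mul_rpow_sub hξ hα hs).const_mul _) measurableSet_Ioo fun w hw => ?_
  have hw' : 0 < s - w := sub_pos.2 hw.2
  rw [norm_mul, norm_rlKernel _ hw']
  calc (s - w) ^ (α.re - 1) * ‖(Complex.Gamma α)⁻¹‖ * ‖k w‖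
      ≤ (s - w) ^ (α.re - 1) * ‖(Complex.Gamma α)⁻¹‖ * (C * w ^ (ξ - 1)) := by
        have := hC w hw.1 hw.2.le
        have := hw'.le
        gcongr
    _ = _ := by ring

/-- Absolute integrability of the double integral `gα * (k * f)` at `t`: carrying out the `v`-integral
first leaves at most a multiple of `|f(w)| (t - w) ^ (ξ + Re α - 1)`. -/
theorem IsAdmissible.integrable_prod (hf : IntegrableOn f (Ioi 0)) (h : IsAdmissible f ξ t)
    (hα : 0 < α.re) (hξ : 0 < ξ) (hk : Measurable k)
    (hk0 : ∀ u ≤ 0, k u = 0) (hC0 : 0 ≤ C)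
    (hC : ∀ u, 0 < u → u ≤ t → ‖k u‖ ≤ C * u ^ (ξ - 1)) :
    Integrable (Function.uncurry fun v w => rlKernel α (t - v) * (k (v - w) * f w))
      ((volume.restrict (Ioo 0 t)).prod (volume.restrict (Ioo 0 t))) := by
  have hfm := (hf.mono_set (Ioo_subset_Ioi_self : Ioo 0 t ⊆ Ioi 0)).aestronglyMeasurable
  have hmeas : AEStronglyMeasurable
      (Function.uncurry fun v w => rlKernel α (t - v) * (k (v - w) * f w))
      ((volume.restrict (Ioo 0 t)).prod (volume.restrict (Ioo 0 t))) :=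
    ((measurable_rlKernel α).comp (measurable_const.sub measurable_fst)).aestronglyMeasurable.mul
      ((hk.comp (measurable_fst.sub measurable_snd)).aestronglyMeasurable.mul hfm.comp_snd)
  have hshift : ∀ w : ℝ, (fun v => rlKernel α (t - v) * (k (v - w) * f w)) =
      fun v => (fun y => rlKernel α (t - w - y) * k y * f w) (v - w) := by
    intro w
    ext v
    have : t - w - (v - w) = t - v := by ring
    simp only [this]
    ring
  have hint : ∀ w ∈ Ioo 0 t,
      Integrable (fun v => rlKernel α (t - v) * (k (v - w) * f w)) := by
    intro w hw
    rw [hshift]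
    exact ((integrable_rlKernel_mul hα hξ hk hk0 (sub_pos.2 hw.2)
      fun u h1 h2 => hC u h1 (by linarith [hw.1])).mul_const (f w)).comp_sub_right w
  rw [integrable_prod_iff' hmeas]
  refine ⟨?_, ?_⟩
  · filter_upwards [ae_restrict_mem measurableSet_Ioo] with w hw
    exact (hint w hw).integrableOn
  · refine Integrable.mono' (h.const_mul
      (‖(Complex.Gamma α)⁻¹‖ * C * ‖Complex.betaIntegral ξ α.re‖ * t ^ α.re))
      hmeas.norm.prod_swap.integral_prod_right' ?_
    filter_upwards [ae_restrict_mem measurableSet_Ioo] with w hw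
    have hs : 0 < t - w := sub_pos.2 hw.2
    have ht : 0 < t := hw.1.trans hw.2
    rw [Real.norm_of_nonneg (integral_nonneg fun _ => norm_nonneg _)]
    have hle := integral_norm_rlKernel_mul_le (C := C) hα hξ hk hk0 hs
      fun u h1 h2 => hC u h1 (by linarith [hw.1])
    calc ∫ v in Ioo 0 t, ‖rlKernel α (t - v) * (k (v - w) * f w)‖
        ≤ ∫ v, ‖rlKernel α (t - v) * (k (v - w) * f w)‖ :=
          setIntegral_le_integral (hint w hw).norm
            (Filter.Eventually.of_forall fun _ => norm_nonneg _)
      _ = (∫ y, ‖rlKernel α (t - w - y) * k y‖) * ‖f w‖ := by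
          have := fun v => congrFun (hshift w) v
          simp only at this
          simp only [this]
          rw [integral_sub_right_eq_self (fun y => ‖rlKernel α (t - w - y) * k y * f w‖) w,
            ← integral_mul_const]
          simp only [norm_mul]
      _ ≤ ‖(Complex.Gamma α)⁻¹‖ * C * ‖Complex.betaIntegral ξ α.re‖ *
            (t ^ α.re * (t - w) ^ (ξ - 1)) * ‖f w‖ := by
          refine mul_le_mul_of_nonneg_right (hle.trans ?_) (norm_nonneg _)
          have e : (t - w) ^ (ξ + α.re - 1) = (t - w) ^ α.re * (t - w) ^ (ξ - 1) := by
            rw [← Real.rpow_add hs]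
            congr 1
            ring
          rw [e]
          have : (t - w) ^ α.re ≤ t ^ α.re :=
            Real.rpow_le_rpow hs.le (by linarith [hw.1]) hα.le
          gcongr
      _ = _ := by ring

theorem setIntegral_comp_sub_mul (hk0 : ∀ u ≤ 0, k u = 0) {v : ℝ} (hv : v ∈ Ioo 0 t) :
    ∫ w in Ioo 0 t, k (v - w) * f w = ∫ w in Ioo 0 v, k (v - w) * f w := by
  refine setIntegral_eq_of_subset_of_forall_sdiff_eq_zero measurableSet_Ioo
    (Ioo_subset_Ioo_right hv.2.le) fun w hw => ?_
  have : v ≤ w := by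
    by_contra h
    exact hw.2 ⟨hw.1.1, not_le.1 h⟩
  rw [hk0 _ (by linarith), zero_mul]

theorem setIntegral_rlKernel_mul_comp_sub (hk0 : ∀ u ≤ 0, k u = 0) {w : ℝ} (hw : w ∈ Ioo 0 t) :
    ∫ v in Ioo 0 t, rlKernel α (t - v) * (k (v - w) * f w) =
      (∫ y in Ioo 0 (t - w), rlKernel α (t - w - y) * k y) * f w := by
  have hsub := support_rlKernel_mul_subset (α := α) hk0 (t - w)
  have h1 : ∀ v ∉ Ioo 0 t, rlKernel α (t - v) * (k (v - w) * f w) = 0 := by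
    intro v hv
    rcases le_or_gt v 0 with h0 | h0
    · rw [hk0 _ (by linarith [hw.1]), zero_mul, mul_zero]
    · have : t ≤ v := by
        by_contra h'
        exact hv ⟨h0, not_le.1 h'⟩
      rw [rlKernel_of_nonpos _ (by linarith), zero_mul]
  rw [setIntegral_eq_integral_of_forall_compl_eq_zero h1,
    setIntegral_eq_integral_of_forall_compl_eq_zero
      (fun y hy => Function.notMem_support.1 fun h => hy (hsub h)), ← integral_mul_const,
    ← integral_sub_right_eq_self (fun y => rlKernel α (t - w - y) * k y * f w) w]
  refine integral_congr_ae (Filter.Eventually.of_forall fun v => ?_)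
  have : t - w - (v - w) = t - v := by ring
  simp only [this]
  ring

theorem IsAdmissible.integrableOn_rlKernel_mul_conv (hf : IntegrableOn f (Ioi 0))
    (h : IsAdmissible f ξ t) (hα : 0 < α.re) (hξ : 0 < ξ) (hk : Measurable k)
    (hk0 : ∀ u ≤ 0, k u = 0) (hC0 : 0 ≤ C)
    (hC : ∀ u, 0 < u → u ≤ t → ‖k u‖ ≤ C * u ^ (ξ - 1)) :
    IntegrableOn (fun v => rlKernel α (t - v) * ∫ w in Ioo 0 v, k (v - w) * f w) (Ioo 0 t) := by
  refine IntegrableOn.congr_fun (f := fun v => ∫ w in Ioo 0 t, rlKernel α (t - v) *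
    (k (v - w) * f w)) (h.integrable_prod hf hα hξ hk hk0 hC0 hC).integral_prod_left
    (fun v hv => ?_) measurableSet_Ioo
  simp only [integral_const_mul, setIntegral_comp_sub_mul hk0 hv]

/-- Associativity `gα * (k * f) = (gα * k) * f` of convolution at an admissible time. -/
theorem IsAdmissible.rlKernel_conv_conv (hf : IntegrableOn f (Ioi 0))
    (h : IsAdmissible f ξ t) (hα : 0 < α.re) (hξ : 0 < ξ) (hk : Measurable k)
    (hk0 : ∀ u ≤ 0, k u = 0) (hC0 : 0 ≤ C)
    (hC : ∀ u, 0 < u → u ≤ t → ‖k u‖ ≤ C * u ^ (ξ - 1)) :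
    ∫ v in Ioo 0 t, rlKernel α (t - v) * ∫ w in Ioo 0 v, k (v - w) * f w =
      ∫ w in Ioo 0 t, (∫ y in Ioo 0 (t - w), rlKernel α (t - w - y) * k y) * f w := by
  calc ∫ v in Ioo 0 t, rlKernel α (t - v) * ∫ w in Ioo 0 v, k (v - w) * f w
      = ∫ v in Ioo 0 t, ∫ w in Ioo 0 t, rlKernel α (t - v) * (k (v - w) * f w) := by
        refine setIntegral_congr_fun measurableSet_Ioo fun v hv => ?_
        simp only [integral_const_mul, setIntegral_comp_sub_mul hk0 hv]
    _ = ∫ w in Ioo 0 t, ∫ v in Ioo 0 t, rlKernel α (t - v) * (k (v - w) * f w) :=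
        integral_integral_swap (h.integrable_prod hf hα hξ hk hk0 hC0 hC)
    _ = _ := by
        exact setIntegral_congr_fun measurableSet_Ioo fun w hw =>
          setIntegral_rlKernel_mul_comp_sub hk0 hw

end Fubini

/-! ### The integral equation in one idempotent component -/

section Solution

variable {ι : Type*} [Fintype ι]

/-- The solution `f + H * f` of the complex equation with `N₀ = 1`. -/
noncomputable def solution (a ν : ι → ℂ) (f : ℝ → ℂ) (t : ℝ) : ℂ :=
  f t + ∫ v in Ioo 0 t, resolvent a ν (t - v) * f v

variable {a ν : ι → ℂ} {f : ℝ → ℂ} {ξ : ℝ}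

theorem exists_norm_rlKernel_le {α : ℂ} (hξ : ξ ≤ α.re) (t : ℝ) :
    ∃ C : ℝ, ∀ u : ℝ, 0 < u → u ≤ t → ‖rlKernel α u‖ ≤ C * u ^ (ξ - 1) := by
  refine ⟨t ^ (α.re - ξ) * ‖(Complex.Gamma α)⁻¹‖, fun u hu hut => ?_⟩
  rw [norm_rlKernel _ hu]
  have e : u ^ (α.re - 1) = u ^ (α.re - ξ) * u ^ (ξ - 1) := by
    rw [← Real.rpow_add hu]
    congr 1
    ring
  have : u ^ (α.re - ξ) ≤ t ^ (α.re - ξ) :=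
    Real.rpow_le_rpow hu.le hut (by linarith)
  rw [e]
  calc u ^ (α.re - ξ) * u ^ (ξ - 1) * ‖(Complex.Gamma α)⁻¹‖
      ≤ t ^ (α.re - ξ) * u ^ (ξ - 1) * ‖(Complex.Gamma α)⁻¹‖ := by gcongr
    _ = _ := by ring

theorem IsAdmissible.integrableOn_rlKernel_mul_solution (hf : IntegrableOn f (Ioi 0))
    {t : ℝ} (ht : 0 < t) (h : IsAdmissible f ξ t) (hξ0 : 0 < ξ) (hξ : ∀ i, ξ ≤ (ν i).re) (i : ι) :
    IntegrableOn (fun v => rlKernel (ν i) (t - v) * solution a ν f v) (Ioo 0 t) := by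
  have hν : ∀ i, 0 < (ν i).re := fun i => hξ0.trans_le (hξ i)
  obtain ⟨C, hC0, hC⟩ := exists_norm_resolvent_le a hξ0 hξ ht
  obtain ⟨C', hC'⟩ := exists_norm_rlKernel_le (hξ i) t
  simp only [solution, mul_add]
  exact (h.integrableOn_mul hf (measurable_rlKernel _) hC').add
    (h.integrableOn_rlKernel_mul_conv hf (hν i) hξ0 (measurable_resolvent a hν)
      (fun u hu => resolvent_of_nonpos a ν hu) hC0 hC)

/-- The complex equation `N - f = -∑ aᵢ gᵢ * N` for `N = f + H * f`: after Fubini it is the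
resolvent equation convolved with `f`. -/
theorem IsAdmissible.solution_sub (hf : IntegrableOn f (Ioi 0)) {t : ℝ} (ht : 0 < t)
    (h : IsAdmissible f ξ t) (hξ0 : 0 < ξ) (hξ : ∀ i, ξ ≤ (ν i).re) :
    solution a ν f t - f t =
      -∑ i, a i * ∫ v in Ioo 0 t, rlKernel (ν i) (t - v) * solution a ν f v := by
  have hν : ∀ i, 0 < (ν i).re := fun i => hξ0.trans_le (hξ i)
  obtain ⟨C, hC0, hC⟩ := exists_norm_resolvent_le a hξ0 hξ ht
  have hm := measurable_resolvent a hν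
  have hz : ∀ u ≤ 0, resolvent a ν u = 0 := fun u hu => resolvent_of_nonpos a ν hu
  have hg : ∀ i, IntegrableOn (fun v => rlKernel (ν i) (t - v) * f v) (Ioo 0 t) := fun i => by
    obtain ⟨C', hC'⟩ := exists_norm_rlKernel_le (hξ i) t
    exact h.integrableOn_mul hf (measurable_rlKernel _) hC'
  have hgH : ∀ i, IntegrableOn (fun w =>
      (∫ y in Ioo 0 (t - w), rlKernel (ν i) (t - w - y) * resolvent a ν y) * f w) (Ioo 0 t) := by
    intro i
    have := (h.integrable_prod hf (hν i) hξ0 hm hz hC0 hC).integral_prod_right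
    exact IntegrableOn.congr_fun this
      (fun w hw => setIntegral_rlKernel_mul_comp_sub hz hw) measurableSet_Ioo
  have hsplit : ∀ i, ∫ v in Ioo 0 t, rlKernel (ν i) (t - v) * solution a ν f v =
      ∫ w in Ioo 0 t, (rlKernel (ν i) (t - w) +
        ∫ y in Ioo 0 (t - w), rlKernel (ν i) (t - w - y) * resolvent a ν y) * f w := by
    intro i
    simp only [solution, mul_add, add_mul]
    rw [integral_add (hg i) (h.integrableOn_rlKernel_mul_conv hf (hν i) hξ0 hm hz hC0 hC),
      integral_add (hg i) (hgH i), h.rlKernel_conv_conv hf (hν i) hξ0 hm hz hC0 hC]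
  have hint : ∀ i, IntegrableOn (fun w => (rlKernel (ν i) (t - w) +
        ∫ y in Ioo 0 (t - w), rlKernel (ν i) (t - w - y) * resolvent a ν y) * f w)
        (Ioo 0 t) := fun i => by
    simp only [add_mul]
    exact (hg i).add (hgH i)
  rw [solution, add_sub_cancel_left]
  simp only [hsplit, ← integral_const_mul]
  rw [← integral_finsetSum _ fun i _ => (hint i).const_mul (a i), ← integral_neg]
  refine setIntegral_congr_fun measurableSet_Ioo fun w hw => ?_
  rw [resolvent_eq a hξ0 hξ (sub_pos.2 hw.2), neg_mul, Finset.sum_mul]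
  simp only [mul_assoc]

end Solution

/-! ### Local integrability and almost every time -/

theorem integrable_indicator_rpow {ξ : ℝ} (hξ : 0 < ξ) {T : ℝ} :
    Integrable ((Ioo 0 T).indicator fun u : ℝ => u ^ (ξ - 1)) := by
  rw [integrable_indicator_iff measurableSet_Ioo]
  exact ((intervalIntegral.intervalIntegrable_rpow'
    (show -1 < ξ - 1 by linarith)).1 : IntegrableOn _ (Ioc 0 T)).mono_set Ioo_subset_Ioc_self

theorem ae_isAdmissible {f : ℝ → ℂ} (hf : IntegrableOn f (Ioi 0)) {ξ : ℝ} (hξ : 0 < ξ) :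
    ∀ᵐ t ∂(volume.restrict (Ioi (0 : ℝ))), IsAdmissible f ξ t := by
  have hF : Integrable ((Ioi (0 : ℝ)).indicator fun v => ‖f v‖) :=
    (integrable_indicator_iff measurableSet_Ioi).2 hf.norm
  have h : ∀ᵐ t : ℝ, ∀ n : ℕ, ConvolutionExistsAt ((Ioi (0 : ℝ)).indicator fun v => ‖f v‖)
      ((Ioo 0 (n : ℝ)).indicator fun u : ℝ => u ^ (ξ - 1)) t (ContinuousLinearMap.mul ℝ ℝ) :=
    ae_all_iff.2 fun n => hF.ae_convolution_exists _ (integrable_indicator_rpow hξ)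
  filter_upwards [ae_restrict_of_ae h] with t ht
  obtain ⟨n, hn⟩ := exists_nat_gt t
  refine (ht n).integrableOn.congr_fun (s := Ioo 0 t) (fun v hv => ?_) measurableSet_Ioo
  have h1 : v ∈ Ioi (0 : ℝ) := hv.1
  have h2 : t - v ∈ Ioo 0 (n : ℝ) := ⟨sub_pos.2 hv.2, by linarith [hv.1]⟩
  simp [indicator_of_mem h1, indicator_of_mem h2]

theorem integrableOn_solution {ι : Type*} [Fintype ι] {a ν : ι → ℂ} {f : ℝ → ℂ}
    (hf : IntegrableOn f (Ioi 0)) {ξ : ℝ} (hξ0 : 0 < ξ) (hξ : ∀ i, ξ ≤ (ν i).re) (T : ℝ) :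
    IntegrableOn (solution a ν f) (Ioo 0 T) := by
  rcases le_or_gt T 0 with hT | hT
  · simp [Ioo_eq_empty (not_lt.2 hT)]
  have hν : ∀ i, 0 < (ν i).re := fun i => hξ0.trans_le (hξ i)
  obtain ⟨C, hC0, hC⟩ := exists_norm_resolvent_le a hξ0 hξ hT
  have hH : Integrable ((Ioo 0 T).indicator (resolvent a ν)) := by
    refine Integrable.mono' ((integrable_indicator_rpow hξ0 (T := T)).const_mul C)
      ((measurable_resolvent a hν).indicator measurableSet_Ioo).aestronglyMeasurable
      (Filter.Eventually.of_forall fun u => ?_)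
    by_cases hu : u ∈ Ioo 0 T
    · simpa [indicator_of_mem hu] using hC u hu.1 hu.2.le
    · simp [indicator_of_notMem hu]
  have hF : Integrable ((Ioi (0 : ℝ)).indicator f) :=
    (integrable_indicator_iff measurableSet_Ioi).2 hf
  have hc := (hF.integrable_convolution (ContinuousLinearMap.mul ℝ ℂ) hH).integrableOn
    (s := Ioo 0 T)
  refine (hf.mono_set Ioo_subset_Ioi_self).add (hc.congr_fun (fun t ht => ?_) measurableSet_Ioo)
  rw [convolution_def, ← integral_indicator measurableSet_Ioo]
  refine integral_congr_ae (Filter.Eventually.of_forall fun v => ?_)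
  simp only [ContinuousLinearMap.mul_apply']
  by_cases hv : v ∈ Ioo 0 t
  · have h1 : v ∈ Ioi (0 : ℝ) := hv.1
    have h2 : t - v ∈ Ioo 0 T := ⟨sub_pos.2 hv.2, by linarith [hv.1, ht.2]⟩
    rw [indicator_of_mem h1, indicator_of_mem h2, indicator_of_mem hv, mul_comm]
  · rw [indicator_of_notMem hv]
    by_cases h1 : v ∈ Ioi (0 : ℝ)
    · have h2 : t - v ∉ Ioo 0 T := fun h => hv ⟨h1, sub_pos.1 h.1⟩
      rw [indicator_of_notMem h2, mul_zero]
    · rw [indicator_of_notMem h1, zero_mul]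

/-! ### Recovering admissibility from one convergent integral -/

/-- If a subfamily of the resolvent series contains the term of order `νᵢ`, with `Re νᵢ` minimal
and `aᵢ ≠ 0`, and otherwise only terms of degree at least `2` and possibly the vanishing term
`r = 0`, then its sum is bounded below by a multiple of `u ^ (Re νᵢ - 1)` near `0`. -/
theorem exists_le_norm_tsum {ι : Type*} [Fintype ι] [DecidableEq ι] {a ν : ι → ℂ} {ξ : ℝ}
    (hξ0 : 0 < ξ) (hξ : ∀ i, ξ ≤ (ν i).re) {i : ι} (hi : (ν i).re = ξ) (hai : a i ≠ 0)
    {κ : ℕ → ι → ℕ} (hκ : Function.Injective κ) {k₀ : ℕ} (hk₀ : κ k₀ = Pi.single i 1)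
    (hk : ∀ k ≠ k₀, κ k = 0 ∨ 2 ≤ ∑ j, κ k j) :
    ∃ ε c : ℝ, 0 < ε ∧ 0 < c ∧ ∀ u : ℝ, 0 < u → u < ε → c * u ^ (ξ - 1) ≤
      ‖∑' k, coeff a (κ k) * rlKernel (weight ν (κ k)) u‖ := by
  have hν : ∀ i, 0 < (ν i).re := fun i => hξ0.trans_le (hξ i)
  obtain ⟨B, hB, hB0, hBb⟩ := exists_summable_bound a ν hν one_pos
  have hBκ : Summable fun k => B (κ k) := hB.comp_injective hκ
  set M := ∑' k, B (κ k) with hM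
  have hM0 : 0 ≤ M := tsum_nonneg fun k => hB0 _
  set c₀ := ‖a i‖ * ‖(Complex.Gamma (ν i))⁻¹‖ with hc₀
  have hc₀pos : 0 < c₀ := mul_pos (norm_pos_iff.2 hai)
    (norm_pos_iff.2 (inv_ne_zero (Complex.Gamma_ne_zero_of_re_pos (hν i))))
  -- The remaining terms are at most `M u ^ (2 ξ - 1)`, so `ε` has to make `M ε ^ ξ ≤ c₀ / 2`.
  obtain ⟨ε, hε0, hε1, hε⟩ : ∃ ε : ℝ, 0 < ε ∧ ε ≤ 1 ∧ M * ε ^ ξ ≤ c₀ / 2 := by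
    have hc : Continuous fun q : ℝ => M * q ^ ξ :=
      continuous_const.mul (continuous_id.rpow_const fun _ => Or.inr hξ0.le)
    have h0 : M * (0 : ℝ) ^ ξ < c₀ / 2 := by
      rw [Real.zero_rpow hξ0.ne', mul_zero]
      positivity
    have he := (hc.tendsto 0).eventually (gt_mem_nhds h0)
    obtain ⟨q, ⟨hq1, hq2⟩, hq3⟩ := (((he.and (gt_mem_nhds one_pos)).filter_mono
      nhdsWithin_le_nhds).and (self_mem_nhdsWithin (s := Ioi (0 : ℝ)))).exists
    exact ⟨q, hq3, hq2.le, hq1.le⟩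
  refine ⟨ε, c₀ / 2, hε0, by positivity, fun u hu huε => ?_⟩
  have hu1 : u ≤ 1 := huε.le.trans hε1
  have hsum : Summable fun k => coeff a (κ k) * rlKernel (weight ν (κ k)) u :=
    (summable_norm_resolvent a hν u).of_norm.comp_injective hκ
  rw [hsum.tsum_eq_add_tsum_ite k₀, hk₀]
  have hlead : ‖coeff a (Pi.single i 1) * rlKernel (weight ν (Pi.single i 1)) u‖ =
      c₀ * u ^ (ξ - 1) := by
    have hw : weight ν (Pi.single i 1) = ν i := by
      simpa [weight_zero] using weight_add_single ν 0 i
    have hc : coeff a (Pi.single i 1) = -a i := by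
      simpa [coeff_zero] using (congrArg (fun z => -z) (mul_coeff_mul_succ a 0 i)).symm
    rw [hw, hc, norm_mul, norm_neg, norm_rlKernel _ hu, hi, hc₀]
    ring
  have hrest : ‖∑' k, if k = k₀ then 0 else coeff a (κ k) * rlKernel (weight ν (κ k)) u‖ ≤
      M * u ^ (2 * ξ - 1) := by
    refine tsum_of_norm_bounded (hBκ.hasSum.mul_right _) fun k => ?_
    have hnn : 0 ≤ B (κ k) * u ^ (2 * ξ - 1) := mul_nonneg (hB0 _) (Real.rpow_nonneg hu.le _)
    split_ifs with hkk
    · simpa using hnn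
    rcases hk k hkk with h0 | h2
    · rw [h0, weight_zero, rlKernel_zero, mul_zero, norm_zero, ← h0]
      exact hnn
    · have h2' : (2 : ℝ) ≤ ((∑ j, κ k j : ℕ) : ℝ) := by exact_mod_cast h2
      have hw : 2 * ξ ≤ (weight ν (κ k)).re :=
        (mul_le_mul_of_nonneg_right h2' hξ0.le).trans (le_weight_re hξ (κ k))
      simpa using hBb (κ k) (2 * ξ) u hw hu hu1
  have hsmall : M * u ^ (2 * ξ - 1) ≤ c₀ / 2 * u ^ (ξ - 1) := by
    have e : u ^ (2 * ξ - 1) = u ^ ξ * u ^ (ξ - 1) := by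
      rw [← Real.rpow_add hu]
      congr 1
      ring
    have : M * u ^ ξ ≤ c₀ / 2 :=
      (mul_le_mul_of_nonneg_left (Real.rpow_le_rpow hu.le huε.le hξ0.le) hM0).trans hε
    rw [e, ← mul_assoc]
    gcongr
  have htri := norm_sub_le_norm_add
    (coeff a (Pi.single i 1) * rlKernel (weight ν (Pi.single i 1)) u)
    (∑' k, if k = k₀ then 0 else coeff a (κ k) * rlKernel (weight ν (κ k)) u)
  rw [hlead] at htri
  linarith

/-- A kernel bounded below by `c u ^ (ξ - 1)` near `0` detects admissibility. -/
theorem isAdmissible_of_integrableOn {f : ℝ → ℂ} (hf : IntegrableOn f (Ioi 0)) {ξ t : ℝ}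
    {k : ℝ → ℂ} {ε c : ℝ} (hε : 0 < ε) (hc : 0 < c)
    (hk : ∀ u : ℝ, 0 < u → u < ε → c * u ^ (ξ - 1) ≤ ‖k u‖)
    (hint : IntegrableOn (fun v => k (t - v) * f v) (Ioo 0 t)) : IsAdmissible f ξ t := by
  have hft : IntegrableOn f (Ioo 0 t) := hf.mono_set Ioo_subset_Ioi_self
  have hmeas : AEStronglyMeasurable (fun v => ‖f v‖ * (t - v) ^ (ξ - 1))
      (volume.restrict (Ioo 0 t)) :=
    hft.aestronglyMeasurable.norm.mul
      ((measurable_const.sub measurable_id).pow_const _).aestronglyMeasurable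
  -- Near `v = t` the integrand is dominated through `hk`; elsewhere `t - v` stays in `[ε, t]`,
  -- where the power is bounded.
  obtain ⟨K, hK⟩ : ∃ K : ℝ, ∀ u ∈ Icc ε t, ‖u ^ (ξ - 1)‖ ≤ K :=
    isCompact_Icc.exists_bound_of_continuousOn
      (continuousOn_id.rpow_const fun u hu => Or.inl (hε.trans_le hu.1).ne')
  refine Integrable.mono' ((hint.norm.const_mul c⁻¹).add (hft.norm.const_mul |K|)) hmeas ?_
  filter_upwards [ae_restrict_mem measurableSet_Ioo] with v hv
  have hpos : 0 < t - v := sub_pos.2 hv.2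
  rw [Real.norm_of_nonneg (by positivity)]
  simp only [Pi.add_apply]
  have h1 : 0 ≤ c⁻¹ * ‖k (t - v) * f v‖ := by positivity
  have h2 : 0 ≤ |K| * ‖f v‖ := by positivity
  rcases lt_or_ge (t - v) ε with h | h
  · have := hk _ hpos h
    have h3 : ‖f v‖ * (t - v) ^ (ξ - 1) ≤ c⁻¹ * ‖k (t - v) * f v‖ := by
      rw [inv_mul_eq_div, le_div_iff₀ hc, norm_mul]
      calc ‖f v‖ * (t - v) ^ (ξ - 1) * c = (c * (t - v) ^ (ξ - 1)) * ‖f v‖ := by ring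
        _ ≤ _ := by gcongr
    linarith
  · have h3 := (Real.le_norm_self _).trans ((hK (t - v) ⟨h, by linarith [hv.1]⟩).trans
      (le_abs_self K))
    have h4 : ‖f v‖ * (t - v) ^ (ξ - 1) ≤ |K| * ‖f v‖ := by
      rw [mul_comm]
      gcongr
    linarith

/-! ### Grouping the multi-index series by its last coordinates -/

section Block

variable {m : ℕ}

/-- The part of the resolvent series with prescribed last coordinates `s`, summed over the first
coordinate. Up to the factor `blockCoeff a s` it is
`u ^ (τ - 1) E^{|s|+1}_{ν₁,τ}(-a₁ u ^ ν₁)`. -/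
noncomputable def blockKernel (a ν : Fin (m + 1) → ℂ) (s : Fin m → ℕ) (u : ℝ) : ℂ :=
  ∑' k : ℕ, coeff a (Fin.cons k s) * rlKernel (weight ν (Fin.cons k s)) u

/-- The factor `(-1) ^ |s| |s|! / ∏ s_μ! ∏ a_{μ+1} ^ s_μ` of the block `s`. -/
noncomputable def blockCoeff (a : Fin (m + 1) → ℂ) (s : Fin m → ℕ) : ℂ :=
  coeff (fun μ : Fin m => a μ.succ) s

/-- The order `τ = ∑ s_μ ν_{μ+1}` of the block `s`. -/
noncomputable def blockOrder (ν : Fin (m + 1) → ℂ) (s : Fin m → ℕ) : ℂ :=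
  weight (fun μ : Fin m => ν μ.succ) s

/-- The `k`-th term of the Prabhakar function in the block `s`. -/
noncomputable def prabhakarTerm (a ν : Fin (m + 1) → ℂ) (s : Fin m → ℕ) (u : ℝ) (k : ℕ) : ℂ :=
  (k.factorial : ℂ)⁻¹ * ((ascPochhammer ℂ k).eval ((∑ μ, (s μ : ℂ)) + 1) *
    (Complex.Gamma (ν 0 * k + blockOrder ν s))⁻¹ * (-(a 0) * (u : ℂ) ^ ν 0) ^ k)

theorem weight_cons (ν : Fin (m + 1) → ℂ) (k : ℕ) (s : Fin m → ℕ) :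
    weight ν (Fin.cons k s) = ν 0 * k + blockOrder ν s := by
  simp [weight, blockOrder, Fin.sum_univ_succ, mul_comm]

theorem multinomial_cons_mul_factorial (k : ℕ) (s : Fin m → ℕ) :
    Nat.multinomial Finset.univ (Fin.cons k s : Fin (m + 1) → ℕ) * k.factorial =
      Nat.multinomial Finset.univ s * ((∑ μ, s μ) + 1).ascFactorial k := by
  have h1 := Nat.multinomial_spec Finset.univ (Fin.cons k s : Fin (m + 1) → ℕ)
  have h2 := Nat.multinomial_spec Finset.univ s
  have h3 := Nat.factorial_mul_ascFactorial (∑ μ, s μ) k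
  rw [Fin.prod_univ_succ, Fin.sum_univ_succ] at h1
  simp only [Fin.cons_zero, Fin.cons_succ] at h1
  rw [add_comm k, ← h3, ← h2] at h1
  have hpos : 0 < ∏ j, (s j).factorial := Finset.prod_pos fun j _ => Nat.factorial_pos _
  refine Nat.eq_of_mul_eq_mul_left hpos ?_
  linarith

theorem coeff_mul_rlKernel_cons (a ν : Fin (m + 1) → ℂ) (k : ℕ) (s : Fin m → ℕ) {u : ℝ}
    (hu : 0 < u) :
    coeff a (Fin.cons k s) * rlKernel (weight ν (Fin.cons k s)) u =
      blockCoeff a s * (u : ℂ) ^ (blockOrder ν s - 1) * prabhakarTerm a ν s u k := by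
  have hu0 : (u : ℂ) ≠ 0 := by exact_mod_cast hu.ne'
  have hk : (k.factorial : ℂ) ≠ 0 := by exact_mod_cast k.factorial_ne_zero
  have hP : (ascPochhammer ℂ k).eval ((∑ μ, (s μ : ℂ)) + 1) =
      ((((∑ μ, s μ) + 1).ascFactorial k : ℕ) : ℂ) := by
    rw [← ascPochhammer_nat_eq_ascFactorial, ascPochhammer_eval_cast]
    push_cast
    rfl
  have hm : (Nat.multinomial Finset.univ (Fin.cons k s : Fin (m + 1) → ℕ) : ℂ) =
      (Nat.multinomial Finset.univ s : ℂ) * ((((∑ μ, s μ) + 1).ascFactorial k : ℕ) : ℂ) *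
        (k.factorial : ℂ)⁻¹ := by
    rw [eq_mul_inv_iff_mul_eq₀ hk]
    exact_mod_cast multinomial_cons_mul_factorial k s
  have hpow : (u : ℂ) ^ (ν 0 * k + blockOrder ν s - 1) =
      (u : ℂ) ^ (blockOrder ν s - 1) * ((u : ℂ) ^ ν 0) ^ k := by
    rw [← Complex.cpow_mul_nat, ← Complex.cpow_add _ _ hu0]
    congr 1
    ring
  rw [weight_cons, rlKernel_of_pos _ hu, hpow, coeff, hm, prabhakarTerm, hP, blockCoeff, coeff,
    Fin.sum_univ_succ, Fin.prod_univ_succ]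
  simp only [Fin.cons_zero, Fin.cons_succ]
  rw [neg_mul, neg_pow (a 0 * _), mul_pow, pow_add]
  ring

theorem blockCoeff_ne_zero {a : Fin (m + 1) → ℂ} (ha : ∀ i, a i ≠ 0) (s : Fin m → ℕ) :
    blockCoeff a s ≠ 0 := by
  refine mul_ne_zero (mul_ne_zero (pow_ne_zero _ (by norm_num)) ?_)
    (Finset.prod_ne_zero_iff.2 fun i _ => pow_ne_zero _ (ha _))
  exact_mod_cast (Nat.multinomial_pos _ _).ne'

variable {a ν : Fin (m + 1) → ℂ}

theorem cons_left_injective (s : Fin m → ℕ) :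
    Function.Injective fun k : ℕ => (Fin.cons k s : Fin (m + 1) → ℕ) :=
  Fin.cons_left_injective (α := fun _ => ℕ) s

theorem hasSum_blockKernel (hν : ∀ i, 0 < (ν i).re) (s : Fin m → ℕ) (u : ℝ) :
    HasSum (fun k : ℕ => coeff a (Fin.cons k s) * rlKernel (weight ν (Fin.cons k s)) u)
      (blockKernel a ν s u) :=
  ((summable_norm_resolvent a hν u).of_norm.comp_injective (cons_left_injective s)).hasSum

theorem measurable_blockKernel (hν : ∀ i, 0 < (ν i).re) (s : Fin m → ℕ) :
    Measurable (blockKernel a ν s) :=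
  measurable_of_tendsto_metrizable'
    (f := fun (S : Finset ℕ) u =>
      ∑ k ∈ S, coeff a (Fin.cons k s) * rlKernel (weight ν (Fin.cons k s)) u)
    Filter.atTop
    (fun S => Finset.measurable_fun_sum S fun _ _ => (measurable_rlKernel _).const_mul _)
    (tendsto_pi_nhds.2 fun u => hasSum_blockKernel hν s u)

theorem summable_prabhakarTerm (ha : ∀ i, a i ≠ 0) (hν : ∀ i, 0 < (ν i).re) (s : Fin m → ℕ)
    {u : ℝ} (hu : 0 < u) : Summable (prabhakarTerm a ν s u) := by
  have h := (hasSum_blockKernel (a := a) hν s u).summable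
  simp only [coeff_mul_rlKernel_cons a ν _ s hu] at h
  have hu0 : (u : ℂ) ^ (blockOrder ν s - 1) ≠ 0 := by
    rw [Complex.cpow_ne_zero_iff]
    exact Or.inl (by exact_mod_cast hu.ne')
  exact (summable_mul_left_iff (mul_ne_zero (blockCoeff_ne_zero ha s) hu0)).1 h

theorem blockKernel_eq (a ν : Fin (m + 1) → ℂ) (s : Fin m → ℕ) {u : ℝ} (hu : 0 < u) :
    blockKernel a ν s u = blockCoeff a s * (u : ℂ) ^ (blockOrder ν s - 1) *
      ∑' k, prabhakarTerm a ν s u k := by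
  simp only [blockKernel, coeff_mul_rlKernel_cons a ν _ s hu, tsum_mul_left]

theorem hasSum_cons_iff {E : Type*} [AddCommMonoid E] [TopologicalSpace E]
    {F : (Fin (m + 1) → ℕ) → E} {A : E} :
    HasSum (fun p : (Fin m → ℕ) × ℕ => F (Fin.cons p.2 p.1)) A ↔ HasSum F A :=
  ((Equiv.prodComm (Fin m → ℕ) ℕ).trans (Fin.consEquiv fun _ => ℕ)).hasSum_iff

theorem tsum_blockKernel (hν : ∀ i, 0 < (ν i).re) (u : ℝ) :
    ∑' s, blockKernel a ν s u = resolvent a ν u :=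
  ((hasSum_cons_iff.2 (hasSum_resolvent a hν u)).prod_fiberwise
    fun s => hasSum_blockKernel hν s u).tsum_eq

theorem exists_norm_blockKernel_le (a : Fin (m + 1) → ℂ) {ξ : ℝ} (hξ0 : 0 < ξ)
    (hξ : ∀ i, ξ ≤ (ν i).re) {T : ℝ} (hT : 0 < T) :
    ∃ B : (Fin m → ℕ) → ℝ, Summable B ∧
      ∀ s u, 0 < u → u ≤ T → ‖blockKernel a ν s u‖ ≤ B s * u ^ (ξ - 1) := by
  obtain ⟨B, hB, hB0, hBb⟩ := norm_coeff_mul_rlKernel_le (a := a) hξ0 hξ hT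
  have hB' : Summable fun p : (Fin m → ℕ) × ℕ => B (Fin.cons p.2 p.1) :=
    (hasSum_cons_iff.2 hB.hasSum).summable
  refine ⟨fun s => ∑' k, B (Fin.cons k s), hB'.prod, fun s u hu huT => ?_⟩
  exact tsum_of_norm_bounded ((hB.comp_injective (cons_left_injective s)).hasSum.mul_right _)
    fun k => hBb _ u hu huT

theorem hasSum_piAntidiag {E : Type*} [NormedAddCommGroup E] [CompleteSpace E]
    {F : (Fin m → ℕ) → E} {A : E} (h : HasSum F A) :
    HasSum (fun l => ∑ s ∈ Finset.piAntidiag (Finset.univ : Finset (Fin m)) l, F s) A := by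
  refine (h.tsum_fiberwise fun s => ∑ μ, s μ).congr_fun fun l => ?_
  have : (fun s : Fin m → ℕ => ∑ μ, s μ) ⁻¹' {l} =
      ↑(Finset.piAntidiag (Finset.univ : Finset (Fin m)) l) := by
    ext s
    simp [Finset.mem_piAntidiag]
  rw [this, Finset.tsum_subtype']

/-- If all the block integrals converge at `t`, then so does the convolution of `f` with the most
singular of the kernels: it is the leading part of one of the blocks `s = 0`, `s = e_μ`. -/
theorem isAdmissible_of_forall_block (ha : ∀ i, a i ≠ 0) {f : ℝ → ℂ}
    (hf : IntegrableOn f (Ioi 0)) {i : Fin (m + 1)} (hi0 : 0 < (ν i).re)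
    (hi : ∀ j, (ν i).re ≤ (ν j).re) {t : ℝ}
    (h : ∀ s, IntegrableOn (fun v => blockKernel a ν s (t - v) * f v) (Ioo 0 t)) :
    IsAdmissible f (ν i).re t := by
  have key : ∀ (s : Fin m → ℕ) (k₀ : ℕ), (Fin.cons k₀ s : Fin (m + 1) → ℕ) = Pi.single i 1 →
      (∀ k ≠ k₀, (Fin.cons k s : Fin (m + 1) → ℕ) = 0 ∨
        2 ≤ ∑ j, (Fin.cons k s : Fin (m + 1) → ℕ) j) → IsAdmissible f (ν i).re t := by
    intro s k₀ h1 h2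
    obtain ⟨ε, c, hε, hc, hk⟩ := exists_le_norm_tsum hi0 hi rfl (ha i)
      (cons_left_injective s) h1 h2
    exact isAdmissible_of_integrableOn hf hε hc hk (h s)
  induction i using Fin.cases with
  | zero =>
    refine key 0 1 ?_ fun k hk => ?_
    · ext j
      induction j using Fin.cases with
      | zero => simp
      | succ j => simp
    · rcases Nat.eq_zero_or_pos k with rfl | hk'
      · left
        ext j
        induction j using Fin.cases with
        | zero => simp
        | succ j => simp
      · right
        simp only [Fin.sum_univ_succ, Fin.cons_zero, Fin.cons_succ]
        simp
        omega
  | succ μ =>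
    refine key (Pi.single μ 1) 0 ?_ fun k hk => Or.inr ?_
    · ext j
      induction j using Fin.cases with
      | zero => simp
      | succ j => simp [Pi.single_apply]
    · simp only [Fin.sum_univ_succ, Fin.cons_zero, Fin.cons_succ]
      simp
      omega

end Block

/-! ### Idempotent components -/

section Idempotent

open Bicomplex

/-- The two idempotent components `P₁` (for `true`) and `P₂` (for `false`) as homomorphisms of
real algebras. -/
noncomputable def idem (b : Bool) : Bicomplex →ₐ[ℝ] ℂ where
  toFun ζ := bif b then P₁ ζ else P₂ ζ
  map_one' := by cases b <;> simp [P₁, P₂, re_one, im_one]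
  map_mul' x y := by
    cases b <;> simp [P₁, P₂] <;> linear_combination (-(x.im * y.im)) * Complex.I_sq
  map_zero' := by cases b <;> simp [P₁, P₂]
  map_add' x y := by cases b <;> simp [P₁, P₂] <;> ring
  commutes' r := by
    cases b <;> simp [P₁, P₂, Algebra.algebraMap_eq_smul_one, re_one, im_one]

theorem idem_true (ζ : Bicomplex) : idem true ζ = P₁ ζ := rfl

theorem idem_false (ζ : Bicomplex) : idem false ζ = P₂ ζ := rfl

/-- The continuous linear map underlying `idem b`. -/
noncomputable def idemL (b : Bool) : Bicomplex →L[ℝ] ℂ :=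
  LinearMap.toContinuousLinearMap (idem b).toLinearMap

theorem idem_ofIdem (b : Bool) (z : Bool → ℂ) : idem b (ofIdem (z true) (z false)) = z b := by
  cases b <;> simp [idem, P₁, P₂, ofIdem, e₁, e₂, j, i₁, i₂, re_one, im_one] <;>
    ring_nf <;> simp [Complex.I_sq] <;> ring

/-- The embedding `z ↦ z e_b` of a component. -/
noncomputable def ofIdemL (b : Bool) : ℂ →L[ℝ] Bicomplex :=
  LinearMap.toContinuousLinearMap
    ((LinearMap.toSpanSingleton ℂ Bicomplex (bif b then e₁ else e₂)).restrictScalars ℝ)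

theorem ofIdemL_add_ofIdemL (ζ : Bicomplex) :
    ofIdemL true (idem true ζ) + ofIdemL false (idem false ζ) = ζ :=
  ofIdem_P ζ

theorem ext_idem {x y : Bicomplex} (h : ∀ b, idem b x = idem b y) : x = y := by
  rw [← ofIdemL_add_ofIdemL x, ← ofIdemL_add_ofIdemL y, h, h]

theorem integrable_of_idem {μ : Measure ℝ} {F : ℝ → Bicomplex}
    (h : ∀ b, Integrable (fun v => idem b (F v)) μ) : Integrable F μ := by
  have := ((ofIdemL true).integrable_comp (h true)).add ((ofIdemL false).integrable_comp (h false))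
  refine this.congr (Filter.Eventually.of_forall fun v => ?_)
  exact ofIdemL_add_ofIdemL (F v)

theorem hasSum_of_idem {κ : Type*} {F : κ → Bicomplex} {A : Bool → ℂ}
    (h : ∀ b, HasSum (fun k => idem b (F k)) (A b)) :
    HasSum F (ofIdem (A true) (A false)) := by
  have := ((ofIdemL true).hasSum (h true)).add ((ofIdemL false).hasSum (h false))
  refine HasSum.congr_fun (g := F) this fun k => ?_
  exact (ofIdemL_add_ofIdemL (F k)).symm

theorem idem_integral (b : Bool) {μ : Measure ℝ} {F : ℝ → Bicomplex} (h : Integrable F μ) :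
    idem b (∫ v, F v ∂μ) = ∫ v, idem b (F v) ∂μ :=
  ((idemL b).integral_comp_comm h).symm

theorem idem_realPow (b : Bool) (t : ℝ) (ζ : Bicomplex) :
    idem b (realPow t ζ) = (t : ℂ) ^ idem b ζ := by
  have := idem_ofIdem b fun b => (t : ℂ) ^ idem b ζ
  exact this

theorem idem_invGamma (b : Bool) (ζ : Bicomplex) :
    idem b (invGamma ζ) = (Complex.Gamma (idem b ζ))⁻¹ := by
  have := idem_ofIdem b fun b => (Complex.Gamma (idem b ζ))⁻¹
  exact this

theorem idem_re_pos {ζ : Bicomplex} (h : |jPart ζ| < Bicomplex.realPart ζ) (b : Bool) :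
    0 < (idem b ζ).re := by
  rw [abs_lt] at h
  simp only [jPart, Bicomplex.realPart] at h
  cases b
  · simp [idem_false, P₂]
    linarith
  · simp [idem_true, P₁]
    linarith

end Idempotent

/-! ### Transfer to bicomplex numbers -/

section Transfer

open Bicomplex

variable {m : ℕ} {a ν : Fin (m + 1) → Bicomplex} {f : ℝ → Bicomplex}

theorem idem_prabhakar (ha : ∀ b i, idem b (a i) ≠ 0) (hν : ∀ b i, 0 < (idem b (ν i)).re)
    (b : Bool) (s : Fin m → ℕ) {u : ℝ} (hu : 0 < u) :
    idem b (prabhakar (ν 0) (∑ μ, (s μ : Bicomplex) * ν μ.succ) ((∑ μ, (s μ : Bicomplex)) + 1)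
      (-(a 0) * realPow u (ν 0))) =
      ∑' k, prabhakarTerm (fun i => idem b (a i)) (fun i => idem b (ν i)) s u k := by
  have hterm : ∀ b (k : ℕ), idem b (((k.factorial : ℝ)⁻¹) •
      ((ascPochhammer Bicomplex k).eval ((∑ μ, (s μ : Bicomplex)) + 1) *
        invGamma (ν 0 * (k : Bicomplex) + ∑ μ, (s μ : Bicomplex) * ν μ.succ) *
        (-(a 0) * realPow u (ν 0)) ^ k)) =
      prabhakarTerm (fun i => idem b (a i)) (fun i => idem b (ν i)) s u k := by
    intro b k
    have hP : idem b ((ascPochhammer Bicomplex k).eval ((∑ μ, (s μ : Bicomplex)) + 1)) =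
        (ascPochhammer ℂ k).eval ((∑ μ, (s μ : ℂ)) + 1) := by
      have := Polynomial.eval_map_apply (p := ascPochhammer Bicomplex k)
        (idem b : Bicomplex →+* ℂ) ((∑ μ, (s μ : Bicomplex)) + 1)
      rw [ascPochhammer_map] at this
      simpa using this.symm
    rw [map_smul, map_mul, map_mul, hP, idem_invGamma, prabhakarTerm, blockOrder, weight]
    simp [idem_realPow]
  have hs := hasSum_of_idem (F := fun k : ℕ => ((k.factorial : ℝ)⁻¹) •
      ((ascPochhammer Bicomplex k).eval ((∑ μ, (s μ : Bicomplex)) + 1) *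
        invGamma (ν 0 * (k : Bicomplex) + ∑ μ, (s μ : Bicomplex) * ν μ.succ) *
        (-(a 0) * realPow u (ν 0)) ^ k))
    (A := fun b => ∑' k, prabhakarTerm (fun i => idem b (a i)) (fun i => idem b (ν i)) s u k)
    fun b => by
      simp only [hterm]
      exact (summable_prabhakarTerm (ha b) (hν b) s hu).hasSum
  rw [prabhakar, hs.tsum_eq, idem_ofIdem b fun b =>
    ∑' k, prabhakarTerm (fun i => idem b (a i)) (fun i => idem b (ν i)) s u k]

theorem blockCoeff_mul_idem_seriesIntegrand (ha : ∀ b i, idem b (a i) ≠ 0)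
    (hν : ∀ b i, 0 < (idem b (ν i)).re) (b : Bool) (s : Fin m → ℕ) {t v : ℝ} (hv : v < t) :
    blockCoeff (fun i => idem b (a i)) s * idem b (seriesIntegrand a ν f s t v) =
      blockKernel (fun i => idem b (a i)) (fun i => idem b (ν i)) s (t - v) * idem b (f v) := by
  rw [blockKernel_eq _ _ _ (sub_pos.2 hv), seriesIntegrand, map_mul, map_mul,
    idem_prabhakar ha hν b s (sub_pos.2 hv), idem_realPow, blockOrder, weight]
  simp only [map_sub, map_sum, map_mul, map_natCast, map_one]
  ring

theorem integrableOn_block (ha : ∀ b i, idem b (a i) ≠ 0)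
    (hν : ∀ b i, 0 < (idem b (ν i)).re) (b : Bool) (s : Fin m → ℕ) {t : ℝ}
    (h : IntegrableOn (seriesIntegrand a ν f s t) (Ioo 0 t)) :
    IntegrableOn (fun v => blockKernel (fun i => idem b (a i)) (fun i => idem b (ν i)) s (t - v) *
      idem b (f v)) (Ioo 0 t) :=
  IntegrableOn.congr_fun (((idemL b).integrable_comp h).const_mul
      (blockCoeff (fun i => idem b (a i)) s))
    (fun _ hv => blockCoeff_mul_idem_seriesIntegrand ha hν b s hv.2) measurableSet_Ioo

theorem integrableOn_seriesIntegrand (ha : ∀ b i, idem b (a i) ≠ 0)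
    (hν : ∀ b i, 0 < (idem b (ν i)).re) (s : Fin m → ℕ) {t : ℝ}
    (h : ∀ b, IntegrableOn (fun v => blockKernel (fun i => idem b (a i)) (fun i => idem b (ν i)) s
      (t - v) * idem b (f v)) (Ioo 0 t)) :
    IntegrableOn (seriesIntegrand a ν f s t) (Ioo 0 t) := by
  refine integrable_of_idem fun b => ?_
  refine IntegrableOn.congr_fun ((h b).const_mul (blockCoeff (fun i => idem b (a i)) s)⁻¹)
    (fun v hv => ?_) measurableSet_Ioo
  rw [← blockCoeff_mul_idem_seriesIntegrand ha hν b s hv.2,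
    inv_mul_cancel_left₀ (blockCoeff_ne_zero (ha b) s)]

theorem integrableOn_idem (hf : IntegrableOn f (Ioi 0)) (b : Bool) :
    IntegrableOn (fun v => idem b (f v)) (Ioi 0) :=
  (idemL b).integrable_comp hf

theorem idem_seriesTerm (ha : ∀ b i, idem b (a i) ≠ 0)
    (hν : ∀ b i, 0 < (idem b (ν i)).re) {t : ℝ}
    (h : ∀ s, IntegrableOn (seriesIntegrand a ν f s t) (Ioo 0 t)) (b : Bool) (l : ℕ) :
    idem b (seriesTerm a ν f t l) =
      ∑ s ∈ Finset.piAntidiag (Finset.univ : Finset (Fin m)) l, ∫ v in Ioo 0 t,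
        blockKernel (fun i => idem b (a i)) (fun i => idem b (ν i)) s (t - v) * idem b (f v) := by
  rw [seriesTerm, map_mul, map_sum, Finset.mul_sum]
  refine Finset.sum_congr rfl fun s hs => ?_
  have hl : ∑ μ, s μ = l := (Finset.mem_piAntidiag.1 hs).1
  have e : ∫ v in Ioo 0 t,
      blockKernel (fun i => idem b (a i)) (fun i => idem b (ν i)) s (t - v) * idem b (f v) =
      blockCoeff (fun i => idem b (a i)) s *
        ∫ v in Ioo 0 t, idem b (seriesIntegrand a ν f s t v) := by
    rw [← integral_const_mul]
    exact setIntegral_congr_fun measurableSet_Ioo fun v hv =>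
      (blockCoeff_mul_idem_seriesIntegrand ha hν b s hv.2).symm
  rw [e, map_mul, map_mul, idem_integral b (h s), blockCoeff, coeff, hl]
  simp only [map_pow, map_neg, map_one, map_natCast, map_prod]
  ring

variable {ξ : Bool → ℝ}

theorem hasSum_idem_seriesTerm (ha : ∀ b i, idem b (a i) ≠ 0) (hξ0 : ∀ b, 0 < ξ b)
    (hξ : ∀ b i, ξ b ≤ (idem b (ν i)).re) (hf : IntegrableOn f (Ioi 0)) {t : ℝ} (ht : 0 < t)
    (h : ∀ s, IntegrableOn (seriesIntegrand a ν f s t) (Ioo 0 t)) (b : Bool)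
    (hadm : IsAdmissible (fun v => idem b (f v)) (ξ b) t) :
    HasSum (fun l => idem b (seriesTerm a ν f t l))
      (∫ v in Ioo 0 t, resolvent (fun i => idem b (a i)) (fun i => idem b (ν i)) (t - v) *
        idem b (f v)) := by
  have hν : ∀ b i, 0 < (idem b (ν i)).re := fun b i => (hξ0 b).trans_le (hξ b i)
  obtain ⟨B, hB, hBb⟩ := exists_norm_blockKernel_le (fun i => idem b (a i)) (hξ0 b) (hξ b) ht
  have hs := hadm.hasSum_integral (integrableOn_idem hf b)
    (fun s => measurable_blockKernel (a := fun i => idem b (a i)) (hν b) s) hB hBb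
  simp only [tsum_blockKernel (hν b)] at hs
  simpa only [idem_seriesTerm ha hν h b] using hasSum_piAntidiag hs

theorem idem_kineticSolution (ha : ∀ b i, idem b (a i) ≠ 0) (hξ0 : ∀ b, 0 < ξ b)
    (hξ : ∀ b i, ξ b ≤ (idem b (ν i)).re) (hf : IntegrableOn f (Ioi 0)) (N₀ : Bicomplex)
    {t : ℝ} (ht : 0 < t) (h : ∀ s, IntegrableOn (seriesIntegrand a ν f s t) (Ioo 0 t))
    (hadm : ∀ b, IsAdmissible (fun v => idem b (f v)) (ξ b) t) (b : Bool) :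
    idem b (kineticSolution a ν N₀ f t) = idem b N₀ *
      solution (fun i => idem b (a i)) (fun i => idem b (ν i)) (fun v => idem b (f v)) t := by
  have hs := hasSum_of_idem fun b => hasSum_idem_seriesTerm ha hξ0 hξ hf ht h b (hadm b)
  rw [kineticSolution, map_mul, map_add, hs.tsum_eq, idem_ofIdem b fun b =>
    ∫ v in Ioo 0 t, resolvent (fun i => idem b (a i)) (fun i => idem b (ν i)) (t - v) *
      idem b (f v), solution]

theorem ae_integrableOn_seriesIntegrand (ha : ∀ b i, idem b (a i) ≠ 0) (hξ0 : ∀ b, 0 < ξ b)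
    (hξ : ∀ b i, ξ b ≤ (idem b (ν i)).re) (hf : IntegrableOn f (Ioi 0)) :
    ∀ᵐ t ∂(volume.restrict (Ioi (0 : ℝ))), ∀ s : Fin m → ℕ,
      IntegrableOn (seriesIntegrand a ν f s t) (Ioo 0 t) := by
  have hν : ∀ b i, 0 < (idem b (ν i)).re := fun b i => (hξ0 b).trans_le (hξ b i)
  have h := ae_all_iff.2 fun b => ae_isAdmissible (integrableOn_idem hf b) (hξ0 b)
  filter_upwards [h, ae_restrict_mem measurableSet_Ioi] with t ht ht0 s
  refine integrableOn_seriesIntegrand ha hν s fun b => ?_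
  obtain ⟨B, _, hBb⟩ := exists_norm_blockKernel_le (fun i => idem b (a i)) (hξ0 b) (hξ b)
    (show (0 : ℝ) < t from ht0)
  exact (ht b).integrableOn_mul (integrableOn_idem hf b) (measurable_blockKernel (hν b) s)
    (hBb s)

/-- In each component `N` is almost everywhere the solution of the complex equation. -/
theorem ae_idem_kineticSolution (ha : ∀ b i, idem b (a i) ≠ 0) (hξ0 : ∀ b, 0 < ξ b)
    (hξ : ∀ b i, ξ b ≤ (idem b (ν i)).re) (hf : IntegrableOn f (Ioi 0)) (N₀ : Bicomplex)
    (b : Bool) (T : ℝ) :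
    ∀ᵐ t ∂(volume.restrict (Ioo 0 T)), idem b (kineticSolution a ν N₀ f t) = idem b N₀ *
      solution (fun i => idem b (a i)) (fun i => idem b (ν i)) (fun v => idem b (f v)) t := by
  have h := ae_all_iff.2 fun b => ae_isAdmissible (integrableOn_idem hf b) (hξ0 b)
  filter_upwards [ae_restrict_of_ae_restrict_of_subset Ioo_subset_Ioi_self h,
    ae_restrict_of_ae_restrict_of_subset Ioo_subset_Ioi_self
      (ae_integrableOn_seriesIntegrand ha hξ0 hξ hf),
    ae_restrict_mem measurableSet_Ioo] with t hadm ht ht0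
  exact idem_kineticSolution ha hξ0 hξ hf N₀ ht0.1 ht hadm b

theorem integrableOn_kineticSolution (ha : ∀ b i, idem b (a i) ≠ 0) (hξ0 : ∀ b, 0 < ξ b)
    (hξ : ∀ b i, ξ b ≤ (idem b (ν i)).re) (hf : IntegrableOn f (Ioi 0)) (N₀ : Bicomplex)
    (T : ℝ) : IntegrableOn (kineticSolution a ν N₀ f) (Ioo 0 T) := by
  refine integrable_of_idem fun b => ?_
  refine Integrable.congr ((integrableOn_solution (a := fun i => idem b (a i))
    (integrableOn_idem hf b) (hξ0 b) (hξ b) T).const_mul (idem b N₀)) ?_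
  filter_upwards [ae_idem_kineticSolution ha hξ0 hξ hf N₀ b T] with t ht using ht.symm

theorem ae_idem_rlIntegrand (ha : ∀ b i, idem b (a i) ≠ 0) (hξ0 : ∀ b, 0 < ξ b)
    (hξ : ∀ b i, ξ b ≤ (idem b (ν i)).re) (hf : IntegrableOn f (Ioi 0)) (N₀ : Bicomplex)
    (t : ℝ) (b : Bool) (i : Fin (m + 1)) :
    (fun v => (Complex.Gamma (idem b (ν i)))⁻¹ *
      idem b (rlIntegrand (ν i) (kineticSolution a ν N₀ f) t v))
      =ᵐ[volume.restrict (Ioo 0 t)] fun v => idem b N₀ * (rlKernel (idem b (ν i)) (t - v) *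
        solution (fun i => idem b (a i)) (fun i => idem b (ν i)) (fun v => idem b (f v)) v) := by
  filter_upwards [ae_idem_kineticSolution ha hξ0 hξ hf N₀ b t,
    ae_restrict_mem measurableSet_Ioo] with v hv hv0
  rw [rlIntegrand, map_mul, hv, idem_realPow, rlKernel_of_pos _ (sub_pos.2 hv0.2),
    map_sub, map_one]
  ring

theorem integrableOn_rlIntegrand (ha : ∀ b i, idem b (a i) ≠ 0) (hξ0 : ∀ b, 0 < ξ b)
    (hξ : ∀ b i, ξ b ≤ (idem b (ν i)).re) (hf : IntegrableOn f (Ioi 0)) (N₀ : Bicomplex)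
    {t : ℝ} (ht : 0 < t) (hadm : ∀ b, IsAdmissible (fun v => idem b (f v)) (ξ b) t)
    (i : Fin (m + 1)) :
    IntegrableOn (rlIntegrand (ν i) (kineticSolution a ν N₀ f) t) (Ioo 0 t) := by
  refine integrable_of_idem fun b => ?_
  have h1 := ((hadm b).integrableOn_rlKernel_mul_solution (a := fun i => idem b (a i))
    (ν := fun i => idem b (ν i)) (integrableOn_idem hf b) ht (hξ0 b) (hξ b) i).const_mul
    (idem b N₀)
  have hG : (Complex.Gamma (idem b (ν i)))⁻¹ ≠ 0 :=
    inv_ne_zero (Complex.Gamma_ne_zero_of_re_pos ((hξ0 b).trans_le (hξ b i)))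
  exact (integrable_const_mul_iff hG.isUnit _).1
    (h1.congr (ae_idem_rlIntegrand ha hξ0 hξ hf N₀ t b i).symm)

theorem kineticSolution_sub (ha : ∀ b i, idem b (a i) ≠ 0) (hξ0 : ∀ b, 0 < ξ b)
    (hξ : ∀ b i, ξ b ≤ (idem b (ν i)).re) (hf : IntegrableOn f (Ioi 0)) (N₀ : Bicomplex)
    {t : ℝ} (ht : 0 < t) (h : ∀ s, IntegrableOn (seriesIntegrand a ν f s t) (Ioo 0 t))
    (hadm : ∀ b, IsAdmissible (fun v => idem b (f v)) (ξ b) t) :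
    kineticSolution a ν N₀ f t - N₀ * f t =
      -∑ i, a i * rlIntegral (ν i) (kineticSolution a ν N₀ f) t := by
  refine ext_idem fun b => ?_
  have hsol := (hadm b).solution_sub (a := fun i => idem b (a i))
    (ν := fun i => idem b (ν i)) (integrableOn_idem hf b) ht (hξ0 b) (hξ b)
  have hterm : ∀ i, idem b (rlIntegral (ν i) (kineticSolution a ν N₀ f) t) =
      idem b N₀ * ∫ v in Ioo 0 t, rlKernel (idem b (ν i)) (t - v) *
        solution (fun i => idem b (a i)) (fun i => idem b (ν i)) (fun v => idem b (f v)) v := by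
    intro i
    rw [rlIntegral, map_mul, idem_invGamma,
      idem_integral b (integrableOn_rlIntegrand ha hξ0 hξ hf N₀ ht hadm i),
      ← integral_const_mul, integral_congr_ae (ae_idem_rlIntegrand ha hξ0 hξ hf N₀ t b i),
      integral_const_mul]
  rw [map_sub, map_mul, idem_kineticSolution ha hξ0 hξ hf N₀ ht h hadm b, ← mul_sub, hsol,
    map_neg, map_sum, mul_neg, Finset.mul_sum]
  simp only [map_mul, hterm]
  congr 1
  exact Finset.sum_congr rfl fun i _ => by ring

end Transfer

end FractionalKinetic

open FractionalKinetic in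
theorem mainTheorem3 (m : ℕ) (a ν : Fin (m + 1) → Bicomplex) (N₀ : Bicomplex)
    (f : ℝ → Bicomplex)
    (hν : ∀ i, |Bicomplex.jPart (ν i)| < Bicomplex.realPart (ν i))
    (ha : ∀ i, Bicomplex.IsHyperbolic (a i))
    (ha' : ∀ i, |Bicomplex.jPart (a i)| < Bicomplex.realPart (a i))
    (hf : IntegrableOn f (Ioi 0)) :
    -- `N` is locally integrable on `[0, ∞)`
    (∀ T : ℝ, IntegrableOn (Bicomplex.kineticSolution a ν N₀ f) (Ioo 0 T)) ∧
    -- for almost every `t > 0` all integrals in the formula for `N(t)` converge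
    (∀ᵐ t ∂(volume.restrict (Ioi (0 : ℝ))), ∀ s : Fin m → ℕ,
      IntegrableOn (Bicomplex.seriesIntegrand a ν f s t) (Ioo 0 t)) ∧
    -- at every `t > 0` where they converge, the series converges, the fractional integrals
    -- of `N` converge, and the equation holds
    (∀ t : ℝ, 0 < t →
      (∀ s : Fin m → ℕ, IntegrableOn (Bicomplex.seriesIntegrand a ν f s t) (Ioo 0 t)) →
      Summable (Bicomplex.seriesTerm a ν f t) ∧
      (∀ i, IntegrableOn
        (Bicomplex.rlIntegrand (ν i) (Bicomplex.kineticSolution a ν N₀ f) t) (Ioo 0 t)) ∧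
      Bicomplex.kineticSolution a ν N₀ f t - N₀ * f t =
        -∑ i, a i * Bicomplex.rlIntegral (ν i) (Bicomplex.kineticSolution a ν N₀ f) t) := by
  have hνb : ∀ b i, 0 < (idem b (ν i)).re := fun b i => idem_re_pos (hν i) b
  have hab : ∀ b i, idem b (a i) ≠ 0 := fun b i h0 => by
    have := idem_re_pos (ha' i) b
    rw [h0] at this
    simp at this
  choose i₀ hi₀ using fun b => Finite.exists_min fun i => (idem b (ν i)).re
  obtain ⟨ξ, hξi⟩ : ∃ ξ : Bool → ℝ, ∀ b, ξ b = (idem b (ν (i₀ b))).re := ⟨_, fun _ => rfl⟩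
  have hξ0 : ∀ b, 0 < ξ b := fun b => (hνb b (i₀ b)).trans_eq (hξi b).symm
  have hξ : ∀ b i, ξ b ≤ (idem b (ν i)).re := fun b i => (hξi b).trans_le (hi₀ b i)
  refine ⟨integrableOn_kineticSolution hab hξ0 hξ hf N₀,
    ae_integrableOn_seriesIntegrand hab hξ0 hξ hf, fun t ht h => ?_⟩
  have hadm : ∀ b, IsAdmissible (fun v => idem b (f v)) (ξ b) t := fun b => by
    rw [hξi]
    exact isAdmissible_of_forall_block (ν := fun i => idem b (ν i)) (hab b)
      (integrableOn_idem hf b) (hνb b (i₀ b)) (hi₀ b)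
      fun s => integrableOn_block hab hνb b s (h s)
  exact ⟨(hasSum_of_idem fun b =>
      hasSum_idem_seriesTerm hab hξ0 hξ hf ht h b (hadm b)).summable,
    integrableOn_rlIntegrand hab hξ0 hξ hf N₀ ht hadm,
    kineticSolution_sub hab hξ0 hξ hf N₀ ht h hadm⟩
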